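/- Let $d \ge 2$ and $k \ge d+1$ be integers, and let $K$ be a convex body in $\mathbb{R}^d$ (a compact convex set with nonempty interior) of $d$-dimensional Lebesgue measure $\lambda_d(K)=1$. Let $S$ be a set of $n \ge k$ points chosen uniformly and independently at random from $K$. A $k$-hole in $S$ is a set $H \subseteq S$ of $k$ points in convex position (no point of $H$ lies in the convex hull of the other points of $H$) such that the interior of the convex hull of $H$ contains no point of $S$. Let $EH^K_{d,k}(n)$ denote the expected number of $k$-holes in $S$. Then $EH^K_{d,k}(n)$ is in $O(n^d)$ for any fixed $d$ and $k$, with an implied constant that depends only on $d$ and $k$ (not on $K$). More precisely, \[EH^K_{d,k}(n) \leq 2^{d-1}\cdot \left(2d^{2d-1}\binom{k}{\lfloor d/2 \rfloor}\right)^{k-d-1} \cdot \frac{n(n-1) \cdots (n-k+2)}{(k-d-1)! \cdot (n-k+1)^{k-d-1}}.\] -/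

import Mathlib

open MeasureTheory ProbabilityTheory

/-- A convex body in `ℝ^d`: a compact convex set with nonempty interior. -/
def IsConvexBody {d : ℕ} (K : Set (EuclideanSpace ℝ (Fin d))) : Prop :=
  IsCompact K ∧ Convex ℝ K ∧ (interior K).Nonempty

/-- `H` is a `k`-hole in the point set `S`: it consists of `k` points of `S`, these are in convex
position (none of them lies in the convex hull of the others), and the interior of the convex hull
of `H` contains no point of `S`. -/
def IsHole {d : ℕ} (k : ℕ) (S : Set (EuclideanSpace ℝ (Fin d)))
    (H : Finset (EuclideanSpace ℝ (Fin d))) : Prop :=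
  (H : Set (EuclideanSpace ℝ (Fin d))) ⊆ S ∧ H.card = k ∧
    ConvexIndependent ℝ (fun p : H => (p : EuclideanSpace ℝ (Fin d))) ∧
    ∀ p ∈ S, p ∉ interior (convexHull ℝ (H : Set (EuclideanSpace ℝ (Fin d))))

/-- The number of `k`-holes in `S` (used for finite `S`, where the family of holes is finite). -/
noncomputable def numHoles {d : ℕ} (k : ℕ) (S : Set (EuclideanSpace ℝ (Fin d))) : ℕ :=
  {H : Finset (EuclideanSpace ℝ (Fin d)) | IsHole k S H}.ncard

/-- The joint law of `n` points chosen independently and uniformly at random from `K`. -/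
noncomputable def uniformPoints {d : ℕ} (K : Set (EuclideanSpace ℝ (Fin d))) (n : ℕ) :
    Measure (Fin n → EuclideanSpace ℝ (Fin d)) :=
  Measure.pi fun _ : Fin n => cond volume K

/-- The expected number of `k`-holes in a set of `n` points chosen independently and uniformly at
random from `K`. -/
noncomputable def EH {d : ℕ} (K : Set (EuclideanSpace ℝ (Fin d))) (k n : ℕ) : ℝ :=
  ∫ x, (numHoles k (Set.range x) : ℝ) ∂(uniformPoints K n)

/-! Write m = k - d - 1 and r = n - k. Inside a k-hole choose a simplex of maximal volume among
those spanned by its points, and let D be the absolute determinant of its homogeneous coordinates,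
so its volume is D / d!. By maximality the other m points of the hole have all barycentric
coordinates in [-1, 1], which confines them to a region of volume at most 2^d D
(`volume_notEnlarging_le`). The r points outside the hole avoid the open simplex. Given the simplex,
this has probability at most (2^d D)^m (1 - D/d!)^r.

It remains to control the distribution of D uniformly in K. Fix a direction u and let vertex 0 be
opposite the facet whose projection along u is largest. Fix that facet and integrate over the apex
p, in coordinates made of a height t along u and d - 1 affine coordinates in the facet. Since no
other facet projects to a larger volume, the latter lie in half of the cube [-1, 1]^(d-1), of volume
2^(d-2). As D is |t| times a constant determined by the facet, a function Φ of D integrates to at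
most 2^(d-1) times its integral over the positive half-line (`setLIntegral_apex_le`), with no
dependence on K. For the probability above, what is left is a Beta integral, of order
(r+1)^(-(m+1)).

A union bound over the k-subsets, the facet and the apex then gives the estimate. One factor r + 1
cancels against the last factor of n(n-1)...(n-k+1), and the resulting constant is below the stated
one. Almost sure general position and the measurability of hole events justify the passage to index
sets. -/

/-! ### Homogeneous coordinates, determinants and affine frames -/

/-- Homogeneous coordinates of a point, the weight coming first. -/
def homCoord {d : ℕ} (z : EuclideanSpace ℝ (Fin d)) : Fin (d + 1) → ℝ :=
  Fin.cons 1 fun j => z j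

/-- The matrix whose rows are the homogeneous coordinates of a family of points. -/
def homMatrix {d : ℕ} (P : Fin (d + 1) → EuclideanSpace ℝ (Fin d)) :
    Matrix (Fin (d + 1)) (Fin (d + 1)) ℝ :=
  Matrix.of fun i => homCoord (P i)

@[simp] lemma homCoord_zero {d : ℕ} (z : EuclideanSpace ℝ (Fin d)) : homCoord z 0 = 1 := rfl

@[simp] lemma homCoord_succ {d : ℕ} (z : EuclideanSpace ℝ (Fin d)) (j : Fin d) :
    homCoord z j.succ = z j := rfl

lemma homMatrix_update {d : ℕ} (P : Fin (d + 1) → EuclideanSpace ℝ (Fin d)) (i : Fin (d + 1))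
    (q : EuclideanSpace ℝ (Fin d)) :
    homMatrix (Function.update P i q) = (homMatrix P).updateRow i (homCoord q) := by
  ext a b
  by_cases h : a = i
  · subst h; simp [homMatrix]
  · simp [homMatrix, h]

lemma continuous_homCoord {d : ℕ} :
    Continuous (homCoord : EuclideanSpace ℝ (Fin d) → Fin (d + 1) → ℝ) := by
  refine continuous_pi fun j => ?_
  refine Fin.cases ?_ (fun j => ?_) j
  · simpa using continuous_const
  · simp only [homCoord_succ]; fun_prop

lemma continuous_homMatrix {d : ℕ} :
    Continuous (homMatrix : (Fin (d + 1) → EuclideanSpace ℝ (Fin d)) → _) :=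
  continuous_matrix fun i j =>
    (continuous_apply j).comp (continuous_homCoord.comp (continuous_apply i))

/-- The edge vectors issuing from row `k`, after dehomogenization. -/
def edgeMatrix {d : ℕ} (V : Matrix (Fin (d + 1)) (Fin (d + 1)) ℝ) (k : Fin (d + 1)) :
    Matrix (Fin d) (Fin d) ℝ :=
  Matrix.of fun i j => V (k.succAbove i) j.succ - V (k.succAbove i) 0 * V k j.succ

/-- Row `k` has weight 1 and clears the first column; Laplace expansion along that column leaves the
edge vectors. Other rows may have weight 0, in which case they are directions and are not
translated. -/
lemma abs_det_edgeMatrix {d : ℕ} (V : Matrix (Fin (d + 1)) (Fin (d + 1)) ℝ) (k : Fin (d + 1))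
    (hk : V k 0 = 1) : |(edgeMatrix V k).det| = |V.det| := by
  set B : Matrix (Fin (d + 1)) (Fin (d + 1)) ℝ :=
    Matrix.of fun i j => if i = k then V k j else V i j - V i 0 * V k j with hB
  have h1 : V.det = B.det := by
    refine Matrix.det_eq_of_forall_row_eq_smul_add_const
      (fun i => if i = k then 0 else V i 0) k (by simp) fun i j => ?_
    by_cases h : i = k
    · subst h; simp [hB]
    · simp [hB, h]
  have h2 : B.det = (-1) ^ (k : ℕ) * (edgeMatrix V k).det := by
    rw [Matrix.det_succ_column_zero, Finset.sum_eq_single k]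
    · have : B.submatrix k.succAbove Fin.succ = edgeMatrix V k := by
        ext i j
        simp [hB, edgeMatrix, Fin.succAbove_ne]
      rw [this]
      simp [hB, hk]
    · intro b _ hb
      simp [hB, hb, hk]
    · simp
  rw [h1, h2, abs_mul]
  simp

lemma abs_det_updateRow_submatrix {n : Type*} [Fintype n] [DecidableEq n] (V : Matrix n n ℝ)
    (σ : Equiv.Perm n) (i : n) (v : n → ℝ) :
    |((V.submatrix σ id).updateRow i v).det| = |(V.updateRow (σ i) v).det| := by
  have : (V.submatrix σ id).updateRow i v = (V.updateRow (σ i) v).submatrix σ id := by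
    ext a b
    by_cases h : a = i
    · subst h; simp
    · simp [Matrix.updateRow_apply, h]
  rw [this, Matrix.det_permute, abs_mul]
  rcases Int.units_eq_one_or (Equiv.Perm.sign σ) with h | h <;> simp [h]

lemma abs_det_submatrix_perm {n : Type*} [Fintype n] [DecidableEq n] (V : Matrix n n ℝ)
    (σ : Equiv.Perm n) : |(V.submatrix σ id).det| = |V.det| := by
  rw [Matrix.det_permute, abs_mul]
  rcases Int.units_eq_one_or (Equiv.Perm.sign σ) with h | h <;> simp [h]

/-- Replacing row `i` by `u` and row `j` by `v`, or the other way round, gives the same absolute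
determinant. -/
lemma abs_det_updateRow_comm {n : Type*} [Fintype n] [DecidableEq n] (V : Matrix n n ℝ)
    {i j : n} (hij : i ≠ j) (u v : n → ℝ) :
    |((V.updateRow i v).updateRow j u).det| = |((V.updateRow i u).updateRow j v).det| := by
  have : (V.updateRow i v).updateRow j u
      = ((V.updateRow i u).updateRow j v).submatrix (Equiv.swap i j) id := by
    ext a b
    simp only [Matrix.updateRow_apply, Matrix.submatrix_apply, id]
    by_cases ha : a = i
    · subst ha; simp [hij]
    · by_cases hb : a = j
      · subst hb; simp [hij]
      · simp [Equiv.swap_apply_of_ne_of_ne ha hb, ha, hb]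
  rw [this, abs_det_submatrix_perm]

/-- A nonzero vector cannot make all Cramer determinants of a nonsingular matrix vanish. -/
lemma exists_det_updateRow_ne_zero {n : Type*} [Fintype n] [DecidableEq n] {V : Matrix n n ℝ}
    (hV : V.det ≠ 0) {u : n → ℝ} (hu : u ≠ 0) : ∃ i, (V.updateRow i u).det ≠ 0 := by
  by_contra! h
  have h1 : Matrix.cramer V.transpose u = 0 := by
    ext i
    rw [Matrix.cramer_transpose_apply, h i]; rfl
  have h2 := Matrix.mulVec_cramer V.transpose u
  rw [h1, Matrix.mulVec_zero, Matrix.det_transpose] at h2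
  exact hu ((smul_eq_zero.1 h2.symm).resolve_left hV)

/-- The point with affine coordinates `l` in the frame with origin row `k` of `V`. -/
noncomputable def framePoint {d : ℕ} (V : Matrix (Fin (d + 1)) (Fin (d + 1)) ℝ) (k : Fin (d + 1))
    (l : Fin d → ℝ) : EuclideanSpace ℝ (Fin d) :=
  WithLp.toLp 2 ((fun j => V k j.succ) + Matrix.vecMul l (edgeMatrix V k))

/-- The coefficient of the origin row makes the weights add up to 1, so rows of weight 0 do not
contribute to it. Multilinearity then reads every Cramer determinant of the point off its affine
coordinates. -/
lemma homCoord_framePoint {d : ℕ} (V : Matrix (Fin (d + 1)) (Fin (d + 1)) ℝ) (k : Fin (d + 1))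
    (hk : V k 0 = 1) (l : Fin d → ℝ) :
    homCoord (framePoint V k l) =
      ∑ i, (k.insertNth (α := fun _ => ℝ) (1 - ∑ a, l a * V (k.succAbove a) 0) l i) • V i := by
  rw [Fin.sum_univ_succAbove _ k]
  ext j
  refine Fin.cases ?_ (fun j => ?_) j
  · simp [hk]
  · simp only [homCoord_succ, framePoint, edgeMatrix, Pi.add_apply, Matrix.vecMul, dotProduct,
      Fin.insertNth_apply_same, Fin.insertNth_apply_succAbove, Finset.sum_apply, Pi.smul_apply,
      smul_eq_mul, Matrix.of_apply, mul_sub, Finset.sum_sub_distrib, sub_mul, Finset.sum_mul]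
    simp only [one_mul, mul_assoc]
    ring

lemma det_updateRow_framePoint_succAbove {d : ℕ} (V : Matrix (Fin (d + 1)) (Fin (d + 1)) ℝ)
    (k : Fin (d + 1)) (hk : V k 0 = 1) (l : Fin d → ℝ) (i : Fin d) :
    (V.updateRow (k.succAbove i) (homCoord (framePoint V k l))).det = l i * V.det := by
  rw [homCoord_framePoint V k hk, Matrix.det_updateRow_sum]
  simp

lemma det_updateRow_framePoint_self {d : ℕ} (V : Matrix (Fin (d + 1)) (Fin (d + 1)) ℝ)
    (k : Fin (d + 1)) (hk : V k 0 = 1) (l : Fin d → ℝ) :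
    (V.updateRow k (homCoord (framePoint V k l))).det
      = (1 - ∑ a, l a * V (k.succAbove a) 0) * V.det := by
  rw [homCoord_framePoint V k hk, Matrix.det_updateRow_sum]
  simp

/-- Change of variables to affine coordinates in a frame. -/
lemma lintegral_eq_lintegral_framePoint {d : ℕ} (V : Matrix (Fin (d + 1)) (Fin (d + 1)) ℝ)
    (k : Fin (d + 1)) (hk : V k 0 = 1) (hV : V.det ≠ 0)
    {f : EuclideanSpace ℝ (Fin d) → ENNReal} (hf : Measurable f) :
    ∫⁻ z, f z = ENNReal.ofReal |V.det| * ∫⁻ l : Fin d → ℝ, f (framePoint V k l) := by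
  have habs := abs_det_edgeMatrix V k hk
  have hM : ((edgeMatrix V k).transpose).det ≠ 0 := by
    rw [Matrix.det_transpose]
    intro h
    rw [h, abs_zero] at habs
    exact hV (abs_eq_zero.1 habs.symm)
  -- Identification with coordinate space and translation by the origin row preserve volume; only
  -- the linear part contributes a factor.
  rw [← (PiLp.volume_preserving_toLp (Fin d)).lintegral_comp hf,
    ← lintegral_add_left_eq_self _ (fun j => V k j.succ)]
  have hmap := Real.map_matrix_volume_pi_eq_smul_volume_pi hM
  have hg : Measurable fun a : Fin d → ℝ =>
      f (WithLp.toLp 2 ((fun j => V k j.succ) + a)) := by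
    refine hf.comp ?_
    exact (PiLp.volume_preserving_toLp (Fin d)).measurable.comp (measurable_const_add _)
  have hT : Measurable (Matrix.toLin' (edgeMatrix V k).transpose) :=
    (LinearMap.continuous_of_finiteDimensional _).measurable
  have h1 := lintegral_map (μ := volume) hg hT
  rw [hmap, lintegral_smul_measure] at h1
  have h2 : ∫⁻ l : Fin d → ℝ, f (framePoint V k l)
      = ∫⁻ a : Fin d → ℝ, f (WithLp.toLp 2 ((fun j => V k j.succ) +
        Matrix.toLin' (edgeMatrix V k).transpose a)) := by
    refine lintegral_congr fun l => ?_
    rw [framePoint, Matrix.toLin'_apply, Matrix.mulVec_transpose]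
  rw [h2, ← h1, Matrix.det_transpose, smul_eq_mul, ← mul_assoc, ← ENNReal.ofReal_mul (abs_nonneg _),
    abs_inv, habs, mul_inv_cancel₀ (abs_ne_zero.2 hV)]
  simp

/-! ### Explicit volumes and one-dimensional integrals -/

/-- The slice at first coordinate t is the same simplex with bound s - t, so the induction must
allow every s. -/
lemma volume_open_corner_simplex (n : ℕ) : ∀ s : ℝ, 0 < s →
    volume {l : Fin n → ℝ | (∀ i, 0 < l i) ∧ ∑ i, l i < s}
      = ENNReal.ofReal (s ^ n / n.factorial) := by
  induction n with
  | zero =>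
    intro s hs
    have : {l : Fin 0 → ℝ | (∀ i, 0 < l i) ∧ ∑ i, l i < s} = Set.univ := by
      ext l; simp [hs]
    rw [this, volume_pi, Measure.pi_univ]
    simp
  | succ n ih =>
    intro s hs
    have hmeas : MeasurableSet {q : ℝ × (Fin n → ℝ) | 0 < q.1 ∧ (∀ i, 0 < q.2 i) ∧
        q.1 + ∑ i, q.2 i < s} := by
      have : {q : ℝ × (Fin n → ℝ) | 0 < q.1 ∧ (∀ i, 0 < q.2 i) ∧ q.1 + ∑ i, q.2 i < s}
          = {q | 0 < q.1} ∩ ((⋂ i, {q | 0 < q.2 i}) ∩ {q | q.1 + ∑ i, q.2 i < s}) := by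
        ext q; simp
      rw [this]
      refine (measurableSet_lt measurable_const measurable_fst).inter
        ((MeasurableSet.iInter fun i => ?_).inter ?_)
      · exact measurableSet_lt measurable_const (by fun_prop)
      · exact measurableSet_lt (by fun_prop) measurable_const
    have h1 : {l : Fin (n + 1) → ℝ | (∀ i, 0 < l i) ∧ ∑ i, l i < s}
        = (MeasurableEquiv.piFinSuccAbove (fun _ : Fin (n + 1) => ℝ) 0) ⁻¹'
          {q : ℝ × (Fin n → ℝ) | 0 < q.1 ∧ (∀ i, 0 < q.2 i) ∧ q.1 + ∑ i, q.2 i < s} := by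
      ext l
      simp [Fin.forall_fin_succ, Fin.sum_univ_succ, MeasurableEquiv.piFinSuccAbove, and_assoc,
        Fin.tail]
    rw [h1, (volume_preserving_piFinSuccAbove (fun _ : Fin (n + 1) => ℝ) 0).measure_preimage
      hmeas.nullMeasurableSet, Measure.volume_eq_prod, Measure.prod_apply hmeas]
    have h2 : ∀ t : ℝ, volume (Prod.mk t ⁻¹' {q : ℝ × (Fin n → ℝ) | 0 < q.1 ∧ (∀ i, 0 < q.2 i) ∧
        q.1 + ∑ i, q.2 i < s})
        = (Set.Ioo 0 s).indicator (fun t => ENNReal.ofReal ((s - t) ^ n / n.factorial)) t := by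
      intro t
      by_cases ht : t ∈ Set.Ioo 0 s
      · rw [Set.indicator_of_mem ht, ← ih (s - t) (by linarith [ht.2])]
        congr 1
        ext l
        simp only [Set.mem_preimage, Set.mem_ofPred_eq, ht.1, true_and]
        refine and_congr_right fun _ => ?_
        constructor <;> intro h <;> linarith
      · rw [Set.indicator_of_notMem ht]
        convert! measure_empty (μ := (volume : Measure (Fin n → ℝ)))
        ext l
        simp only [Set.mem_preimage, Set.mem_ofPred_eq, Set.mem_empty_iff_false, iff_false]
        rintro ⟨h1, h2, h3⟩
        have : 0 ≤ ∑ i, l i := Finset.sum_nonneg fun i _ => (h2 i).le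
        exact ht ⟨h1, by linarith⟩
    simp_rw [h2]
    rw [lintegral_indicator measurableSet_Ioo, setLIntegral_congr Ioo_ae_eq_Ioc,
      ← ofReal_integral_eq_lintegral_ofReal, ← intervalIntegral.integral_of_le hs.le]
    · rw [intervalIntegral.integral_div,
        intervalIntegral.integral_comp_sub_left (fun x => x ^ n) s]
      congr 1
      simp only [sub_self, sub_zero, integral_pow, Nat.factorial_succ]
      push_cast
      field_simp
      ring
    · exact (Continuous.integrableOn_Ioc (by fun_prop))
    · filter_upwards [ae_restrict_mem measurableSet_Ioc] with t ht
      have : 0 ≤ s - t := by linarith [ht.2]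
      positivity

lemma volume_cube (n : ℕ) :
    volume {l : Fin n → ℝ | ∀ i, |l i| ≤ 1} = 2 ^ n := by
  have : {l : Fin n → ℝ | ∀ i, |l i| ≤ 1} = Set.univ.pi fun _ => Set.Icc (-1) 1 := by
    ext l; simp [abs_le, Pi.le_def, forall_and]
  rw [this, volume_pi_pi]
  simp only [Real.volume_Icc, Finset.prod_const, Finset.card_univ, Fintype.card_fin]
  norm_num

/-- A central hyperplane halves the cube. -/
lemma volume_half_cube (n : ℕ) :
    volume {l : Fin (n + 1) → ℝ | (∀ i, |l i| ≤ 1) ∧ 0 ≤ ∑ i, l i} = 2 ^ n := by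
  set A : Set (Fin (n + 1) → ℝ) := {l | (∀ i, |l i| ≤ 1) ∧ 0 ≤ ∑ i, l i} with hA
  set B : Set (Fin (n + 1) → ℝ) := {l | (∀ i, |l i| ≤ 1) ∧ ∑ i, l i ≤ 0} with hB
  -- Reflection in the origin exchanges the halves, and they overlap in a hyperplane, a null set.
  have hAB : A = -B := by ext l; simp [hA, hB]
  have hvol : volume A = volume B := by rw [hAB, Measure.measure_neg]
  have hBm : MeasurableSet B := by
    have : B = (⋂ i, {l | |l i| ≤ 1}) ∩ {l | ∑ i, l i ≤ 0} := by ext l; simp [hB]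
    rw [this]
    refine (MeasurableSet.iInter fun i => ?_).inter
      (measurableSet_le (by fun_prop) measurable_const)
    exact measurableSet_le (measurable_pi_apply i).abs measurable_const
  have hun : A ∪ B = {l | ∀ i, |l i| ≤ 1} := by
    ext l
    simp only [hA, hB, Set.mem_union, Set.mem_ofPred_eq]
    have := le_total 0 (∑ i, l i)
    tauto
  have hint : volume (A ∩ B) = 0 := by
    let φ : (Fin (n + 1) → ℝ) →ₗ[ℝ] ℝ := ∑ i, LinearMap.proj i
    have hφ : ∀ l, φ l = ∑ i, l i := fun l => by simp [φ]
    refine measure_mono_null (t := (LinearMap.ker φ : Set (Fin (n + 1) → ℝ))) ?_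
      (Measure.addHaar_submodule _ _ ?_)
    · rintro l ⟨h1, h2⟩
      exact (hφ l).trans (le_antisymm h2.2 h1.2)
    · intro h
      have h1 : (fun _ => 1 : Fin (n + 1) → ℝ) ∈ LinearMap.ker φ := by rw [h]; trivial
      rw [LinearMap.mem_ker, hφ] at h1
      simp at h1
      norm_cast at h1
  have h := measure_union_add_inter A hBm (μ := volume)
  rw [hun, hint, volume_cube, ← hvol, add_zero, ← two_mul, pow_succ, mul_comm] at h
  exact ((ENNReal.mul_right_inj (by norm_num) (by norm_num)).1 h).symm

/-- Integration by parts trades a factor v for a factor 1 - v at the cost of (m+1)/(r+1). The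
denominators met are r+1, r+2, ..., each at least r+1. -/
lemma integral_pow_mul_one_sub_pow_le (m : ℕ) : ∀ r : ℕ,
    ∫ v in (0 : ℝ)..1, v ^ m * (1 - v) ^ r ≤ m.factorial / ((r : ℝ) + 1) ^ (m + 1) := by
  induction m with
  | zero =>
    intro r
    simp only [pow_zero, one_mul]
    rw [intervalIntegral.integral_comp_sub_left (fun x => x ^ r) 1]
    simp
  | succ m ih =>
    intro r
    have hd : ∀ v : ℝ, HasDerivAt (fun v : ℝ => v ^ (m + 1) * (1 - v) ^ (r + 1))
        ((m + 1 : ℝ) * (v ^ m * (1 - v) ^ (r + 1)) - (r + 1 : ℝ) * (v ^ (m + 1) * (1 - v) ^ r))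
        v := by
      intro v
      have h1 := (hasDerivAt_pow (m + 1) v).mul
        (((hasDerivAt_id v).const_sub 1).pow (r + 1))
      convert! h1 using 1
      simp
      ring
    have h0 := intervalIntegral.integral_eq_sub_of_hasDerivAt (a := 0) (b := 1)
      (fun v _ => hd v) (Continuous.intervalIntegrable (by fun_prop) _ _)
    rw [intervalIntegral.integral_sub (Continuous.intervalIntegrable (by fun_prop) _ _)
      (Continuous.intervalIntegrable (by fun_prop) _ _), intervalIntegral.integral_const_mul,
      intervalIntegral.integral_const_mul] at h0
    simp at h0
    have hr : (0 : ℝ) < r + 1 := by positivity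
    have h1 := ih (r + 1)
    have h2 : ((m.factorial : ℝ) / (((r + 1 : ℕ) : ℝ) + 1) ^ (m + 1))
        ≤ m.factorial / ((r : ℝ) + 1) ^ (m + 1) := by
      gcongr
      linarith
    have h3 := h1.trans h2
    have h4 : ∫ v in (0 : ℝ)..1, v ^ (m + 1) * (1 - v) ^ r
        = (m + 1) / (r + 1) * ∫ v in (0 : ℝ)..1, v ^ m * (1 - v) ^ (r + 1) := by
      field_simp
      linarith
    rw [h4]
    calc _ ≤ ((m : ℝ) + 1) / (r + 1) * (m.factorial / ((r : ℝ) + 1) ^ (m + 1)) := by gcongr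
      _ = _ := by
        rw [Nat.factorial_succ]; push_cast; field_simp; ring

/-- The weight with which a simplex of normalized volume `D / s` enters the expectation. -/
noncomputable def simplexWeight (s c : ℝ) (m r : ℕ) (D : ℝ) : ENNReal :=
  (Set.Iic s).indicator (fun D => ENNReal.ofReal ((c * D) ^ m * (1 - D / s) ^ r)) D

lemma measurable_simplexWeight (s c : ℝ) (m r : ℕ) : Measurable (simplexWeight s c m r) :=
  Measurable.indicator (by fun_prop) measurableSet_Iic

/-- The substitution D = s v gives the Beta integral. The cutoff at s keeps 1 - D/s nonnegative;
with s = d! it loses nothing, since a simplex inside a body of volume 1 has D ≤ d!. -/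
lemma lintegral_simplexWeight_le {s c : ℝ} (hs : 0 < s) (hc : 0 ≤ c) (m r : ℕ) :
    ∫⁻ D in Set.Ioi 0, simplexWeight s c m r D
      ≤ ENNReal.ofReal (s * (c * s) ^ m * (m.factorial / ((r : ℝ) + 1) ^ (m + 1))) := by
  unfold simplexWeight
  rw [lintegral_indicator measurableSet_Iic, Measure.restrict_restrict measurableSet_Iic,
    Set.inter_comm, Set.Ioi_inter_Iic, ← ofReal_integral_eq_lintegral_ofReal,
    ← intervalIntegral.integral_of_le hs.le]
  · apply ENNReal.ofReal_le_ofReal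
    have h1 := intervalIntegral.integral_comp_div (a := 0) (b := s)
      (fun v => (c * s * v) ^ m * (1 - v) ^ r) hs.ne'
    have h2 : (fun x : ℝ => (c * s * (x / s)) ^ m * (1 - x / s) ^ r)
        = fun x => (c * x) ^ m * (1 - x / s) ^ r := by
      ext x
      congr 2
      field_simp
    rw [h2] at h1
    rw [h1, div_self hs.ne', zero_div]
    simp only [mul_pow (c * s), mul_assoc ((c * s) ^ m), intervalIntegral.integral_const_mul,
      smul_eq_mul]
    rw [← mul_assoc]
    gcongr
    exact integral_pow_mul_one_sub_pow_le m r
  · exact Continuous.integrableOn_Ioc (by fun_prop)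
  · filter_upwards [ae_restrict_mem measurableSet_Ioc] with D hD
    have h1 : 0 ≤ 1 - D / s := by
      rw [sub_nonneg, div_le_one hs]; exact hD.2
    have h2 := hD.1.le
    positivity

/-- The factor 2 accounts for the apex lying on either side of its base facet. -/
lemma lintegral_comp_abs_mul {Φ : ℝ → ENNReal} (hΦ : Measurable Φ) {g : ℝ} (hg : g ≠ 0) :
    ENNReal.ofReal |g| * ∫⁻ t, Φ |t * g| = 2 * ∫⁻ t in Set.Ioi 0, Φ t := by
  have hΦ' : Measurable fun t : ℝ => Φ |t| := hΦ.comp measurable_id.abs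
  have h1 : ENNReal.ofReal |g| * ∫⁻ t, Φ |t * g| = ∫⁻ t, Φ |t| := by
    conv_rhs => rw [← Real.smul_map_volume_mul_right hg]
    rw [lintegral_smul_measure, lintegral_map hΦ' (by fun_prop), smul_eq_mul]
  have h2 : ∫⁻ t in Set.Iio 0, Φ |t| = ∫⁻ t in Set.Ioi 0, Φ |t| := by
    have := (Measure.measurePreserving_neg (volume : Measure ℝ)).setLIntegral_comp_preimage
      (s := Set.Ioi 0) measurableSet_Ioi hΦ'
    rw [← this]
    simp
  have h3 : ∫⁻ t in Set.Ioi 0, Φ |t| = ∫⁻ t in Set.Ioi 0, Φ t :=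
    setLIntegral_congr_fun measurableSet_Ioi fun t ht => by
      simp only [abs_of_pos (Set.mem_Ioi.1 ht)]
  rw [h1, ← lintegral_add_compl _ (measurableSet_Ioi (a := (0 : ℝ))), Set.compl_Ioi,
    setLIntegral_congr Iio_ae_eq_Iic.symm, h2, h3, two_mul]

/-! ### Simplices and the points that do not enlarge them -/

lemma continuous_det_updateRow {X : Type*} [TopologicalSpace X] {n : Type*} [Fintype n]
    [DecidableEq n] {V : X → Matrix n n ℝ} {v : X → n → ℝ} (hV : Continuous V)
    (hv : Continuous v) (i : n) : Continuous fun x => ((V x).updateRow i (v x)).det :=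
  (hV.matrix_updateRow i hv).matrix_det

/-- The interior of the simplex spanned by a nondegenerate family of points, described by the
positivity of the barycentric coordinates. -/
def openSimplex {d : ℕ} (P : Fin (d + 1) → EuclideanSpace ℝ (Fin d)) :
    Set (EuclideanSpace ℝ (Fin d)) :=
  {r | ∀ i, 0 < ((homMatrix P).updateRow i (homCoord r)).det / (homMatrix P).det}

lemma isOpen_openSimplex {d : ℕ} (P : Fin (d + 1) → EuclideanSpace ℝ (Fin d)) :
    IsOpen (openSimplex P) := by
  have : openSimplex P = ⋂ i,
      {r | 0 < ((homMatrix P).updateRow i (homCoord r)).det / (homMatrix P).det} := by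
    ext; simp [openSimplex]
  rw [this]
  exact isOpen_iInter_of_finite fun i => isOpen_lt continuous_const
    ((continuous_det_updateRow continuous_const continuous_homCoord i).div_const _)

/-- Cramer's rule: determinant ratios are the barycentric coordinates. -/
lemma homCoord_eq_sum_det {d : ℕ} {V : Matrix (Fin (d + 1)) (Fin (d + 1)) ℝ} (hV : V.det ≠ 0)
    (v : Fin (d + 1) → ℝ) : v = ∑ i, ((V.updateRow i v).det / V.det) • V i := by
  have h := Matrix.mulVec_cramer V.transpose v
  rw [Matrix.det_transpose] at h
  ext j
  have hj := congrFun h j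
  simp only [Matrix.mulVec, dotProduct, Matrix.transpose_apply, Matrix.cramer_transpose_apply,
    Pi.smul_apply, smul_eq_mul] at hj
  simp only [Finset.sum_apply, Pi.smul_apply, smul_eq_mul]
  refine mul_left_cancel₀ hV ?_
  rw [← hj, Finset.mul_sum]
  exact Finset.sum_congr rfl fun i _ => by field_simp

lemma openSimplex_subset_convexHull {d : ℕ} {P : Fin (d + 1) → EuclideanSpace ℝ (Fin d)}
    (hP : (homMatrix P).det ≠ 0) : openSimplex P ⊆ convexHull ℝ (Set.range P) := by
  intro r hr
  have h := homCoord_eq_sum_det hP (homCoord r)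
  set w : Fin (d + 1) → ℝ :=
    fun i => ((homMatrix P).updateRow i (homCoord r)).det / (homMatrix P).det with hw
  have h0 : ∑ i, w i = 1 := by
    have := congrFun h 0
    simpa [homMatrix, hw] using this.symm
  have h1 : ∑ i, w i • P i = r := by
    ext j
    have := congrFun h j.succ
    simpa [homMatrix, hw] using this.symm
  rw [← h1]
  exact (convex_convexHull ℝ _).sum_mem (fun i _ => (hr i).le) h0
    fun i _ => subset_convexHull ℝ _ ⟨i, rfl⟩

/-- In the frame at vertex 0 this is the corner simplex of volume 1/d!. -/
lemma volume_openSimplex {d : ℕ} {P : Fin (d + 1) → EuclideanSpace ℝ (Fin d)}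
    (hP : (homMatrix P).det ≠ 0) :
    volume (openSimplex P) = ENNReal.ofReal (|(homMatrix P).det| / d.factorial) := by
  have hm := (isOpen_openSimplex P).measurableSet
  rw [← lintegral_indicator_one hm, lintegral_eq_lintegral_framePoint (homMatrix P) 0 rfl hP
    (measurable_one.indicator hm)]
  have h1 : ∀ l, framePoint (homMatrix P) 0 l ∈ openSimplex P
      ↔ l ∈ {l : Fin d → ℝ | (∀ i, 0 < l i) ∧ ∑ i, l i < 1} := by
    intro l
    have ha : ∀ a, homMatrix P a 0 = 1 := fun a => rfl
    have h0 := det_updateRow_framePoint_self (homMatrix P) 0 rfl l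
    have hs := det_updateRow_framePoint_succAbove (homMatrix P) 0 rfl l
    simp only [Fin.zero_succAbove, ha, mul_one] at h0 hs
    simp only [openSimplex, Set.mem_ofPred_eq, Fin.forall_fin_succ, h0, hs,
      mul_div_cancel_right₀ _ hP, sub_pos]
    tauto
  have h2 : ∀ l, (openSimplex P).indicator (1 : EuclideanSpace ℝ (Fin d) → ENNReal) (framePoint (homMatrix P) 0 l)
      = {l : Fin d → ℝ | (∀ i, 0 < l i) ∧ ∑ i, l i < 1}.indicator 1 l := by
    intro l
    by_cases hl : framePoint (homMatrix P) 0 l ∈ openSimplex P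
    · rw [Set.indicator_of_mem hl, Set.indicator_of_mem ((h1 l).1 hl)]; rfl
    · rw [Set.indicator_of_notMem hl, Set.indicator_of_notMem fun h => hl ((h1 l).2 h)]
  have hm2 : MeasurableSet {l : Fin d → ℝ | (∀ i, 0 < l i) ∧ ∑ i, l i < 1} := by
    have : {l : Fin d → ℝ | (∀ i, 0 < l i) ∧ ∑ i, l i < 1}
        = (⋂ i, {l | 0 < l i}) ∩ {l | ∑ i, l i < 1} := by ext; simp
    rw [this]
    exact (MeasurableSet.iInter fun i => measurableSet_lt measurable_const
      (measurable_pi_apply i)).inter (measurableSet_lt (by fun_prop) measurable_const)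
  rw [lintegral_congr h2, lintegral_indicator_one hm2, volume_open_corner_simplex d 1 one_pos,
    ← ENNReal.ofReal_mul (abs_nonneg _), one_pow, mul_one_div]

/-- The points that can replace any vertex of a simplex without enlarging it. -/
def notEnlarging {d : ℕ} (P : Fin (d + 1) → EuclideanSpace ℝ (Fin d)) :
    Set (EuclideanSpace ℝ (Fin d)) :=
  {q | ∀ i, |((homMatrix P).updateRow i (homCoord q)).det| ≤ |(homMatrix P).det|}

lemma measurableSet_notEnlarging {d : ℕ} (P : Fin (d + 1) → EuclideanSpace ℝ (Fin d)) :
    MeasurableSet (notEnlarging P) := by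
  have : notEnlarging P = ⋂ i,
      {q | |((homMatrix P).updateRow i (homCoord q)).det| ≤ |(homMatrix P).det|} := by
    ext; simp [notEnlarging]
  rw [this]
  exact MeasurableSet.iInter fun i => measurableSet_le
    (continuous_det_updateRow continuous_const continuous_homCoord i).measurable.abs
    measurable_const

lemma volume_notEnlarging_le {d : ℕ} {P : Fin (d + 1) → EuclideanSpace ℝ (Fin d)}
    (hP : (homMatrix P).det ≠ 0) :
    volume (notEnlarging P) ≤ ENNReal.ofReal (2 ^ d * |(homMatrix P).det|) := by
  have hm := measurableSet_notEnlarging P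
  rw [← lintegral_indicator_one hm, lintegral_eq_lintegral_framePoint (homMatrix P) 0 rfl hP
    (measurable_one.indicator hm), mul_comm, ENNReal.ofReal_mul (by positivity)]
  gcongr
  calc ∫⁻ l, (notEnlarging P).indicator (1 : EuclideanSpace ℝ (Fin d) → ENNReal) (framePoint (homMatrix P) 0 l)
      ≤ ∫⁻ l, {l : Fin d → ℝ | ∀ i, |l i| ≤ 1}.indicator 1 l := by
        refine lintegral_mono fun l => ?_
        refine Set.indicator_apply_le' (fun hl => ?_) fun _ => zero_le
        rw [Set.indicator_of_mem]
        · simp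
        · intro i
          -- Only the d constraints at vertices other than the origin are kept; they already bound
          -- each affine coordinate by 1.
          have := hl (Fin.succAbove 0 i)
          rw [det_updateRow_framePoint_succAbove (homMatrix P) 0 rfl l, abs_mul] at this
          exact le_of_mul_le_mul_right (by rwa [one_mul]) (abs_pos.2 hP)
    _ ≤ volume {l : Fin d → ℝ | ∀ i, |l i| ≤ 1} := lintegral_indicator_one_le _
    _ = _ := by
      rw [volume_cube, ENNReal.ofReal_pow zero_le_two, ENNReal.ofReal_ofNat]

/-! ### Integration over the apex and over all configurations -/

/-- Integration over the apex of a simplex whose projection along the direction `V 0` lies in the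
region where the base facet projects to the largest volume. -/
lemma setLIntegral_apex_le {n : ℕ} {V : Matrix (Fin (n + 3)) (Fin (n + 3)) ℝ}
    (h0 : V 0 0 = 0) (h1 : ∀ i : Fin (n + 2), V i.succ 0 = 1) (hV : V.det ≠ 0)
    {Φ : ℝ → ENNReal} (hΦ : Measurable Φ) :
    ∫⁻ p in {p | ∀ i : Fin (n + 2), |(V.updateRow i.succ (homCoord p)).det| ≤ |V.det|},
      Φ |(V.updateRow 0 (homCoord p)).det|
      ≤ 2 ^ (n + 1) * ∫⁻ t in Set.Ioi 0, Φ t := by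
  set R : Set (EuclideanSpace ℝ (Fin (n + 2))) :=
    {p | ∀ i : Fin (n + 2), |(V.updateRow i.succ (homCoord p)).det| ≤ |V.det|} with hR
  have hcont : ∀ i, Continuous fun p : EuclideanSpace ℝ (Fin (n + 2)) =>
      (V.updateRow i (homCoord p)).det :=
    fun i => continuous_det_updateRow continuous_const continuous_homCoord i
  have hRm : MeasurableSet R := by
    have : R = ⋂ i : Fin (n + 2), {p | |(V.updateRow i.succ (homCoord p)).det| ≤ |V.det|} := by
      ext; simp [hR]
    rw [this]
    exact MeasurableSet.iInter fun i => measurableSet_le (hcont _).measurable.abs measurable_const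
  -- Row 0 is a direction, so the first base vertex, row 1, is the origin of the frame.
  have hV1 : V 1 0 = 1 := h1 0
  have hΦm : Measurable fun p : EuclideanSpace ℝ (Fin (n + 2)) =>
      Φ |(V.updateRow 0 (homCoord p)).det| := hΦ.comp (hcont 0).measurable.abs
  rw [← lintegral_indicator hRm, lintegral_eq_lintegral_framePoint V 1 hV1 hV
    (hΦm.indicator hRm)]
  set S : Set (Fin (n + 1) → ℝ) := {l | (∀ i, |l i| ≤ 1) ∧ 0 ≤ ∑ i, l i} with hS
  have hSm : MeasurableSet S := by
    have : S = (⋂ i, {l | |l i| ≤ 1}) ∩ {l | 0 ≤ ∑ i, l i} := by ext l; simp [hS]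
    rw [this]
    refine (MeasurableSet.iInter fun i => ?_).inter
      (measurableSet_le measurable_const (by fun_prop))
    exact measurableSet_le (measurable_pi_apply i).abs measurable_const
  have hsa0 : (1 : Fin (n + 3)).succAbove (0 : Fin (n + 2)) = 0 := rfl
  have hsas : ∀ j : Fin (n + 1), (1 : Fin (n + 3)).succAbove j.succ = j.succ.succ := by
    intro j
    exact Fin.one_succAbove_succ j
  have hpt : ∀ l : Fin (n + 2) → ℝ,
      R.indicator (fun p => Φ |(V.updateRow 0 (homCoord p)).det|) (framePoint V 1 l)
      ≤ (fun q : ℝ × (Fin (n + 1) → ℝ) => Φ |q.1 * V.det| * S.indicator 1 q.2)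
        (MeasurableEquiv.piFinSuccAbove (fun _ : Fin (n + 2) => ℝ) 0 l) := by
    intro l
    refine Set.indicator_apply_le' (fun hl => ?_) fun _ => zero_le
    have hD := det_updateRow_framePoint_succAbove V 1 hV1 l 0
    rw [hsa0] at hD
    have hmem : (fun i => l i.succ) ∈ S := by
      have key : ∀ {c : ℝ}, |c * V.det| ≤ |V.det| → |c| ≤ 1 := fun {c} hc => by
        rw [abs_mul] at hc
        exact le_of_mul_le_mul_right (by rwa [one_mul]) (abs_pos.2 hV)
      constructor
      · intro i
        have := hl i.succ
        rw [← hsas, det_updateRow_framePoint_succAbove V 1 hV1 l] at this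
        exact key this
      -- The constraint at the origin vertex reads |1 - ∑ l| ≤ 1, where the coordinate along the
      -- direction drops out. Its upper bound on ∑ l is discarded and ∑ l ≥ 0 halves the cube.
      · have := hl 0
        rw [show (Fin.succ 0 : Fin (n + 3)) = 1 from rfl,
          det_updateRow_framePoint_self V 1 hV1 l] at this
        have := key this
        rw [Fin.sum_univ_succ, hsa0, h0] at this
        simp only [hsas, h1, mul_one, mul_zero, zero_add] at this
        linarith [(abs_le.1 this).2]
    have e1 : (MeasurableEquiv.piFinSuccAbove (fun _ : Fin (n + 2) => ℝ) 0 l)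
        = (l 0, fun i => l i.succ) := rfl
    rw [e1, hD]
    simp [Set.indicator_of_mem hmem]
  have hmeasF : Measurable fun t : ℝ => Φ |t * V.det| := hΦ.comp (by fun_prop)
  set F : ℝ × (Fin (n + 1) → ℝ) → ENNReal := fun q => Φ |q.1 * V.det| * S.indicator 1 q.2 with hF
  have hFm : Measurable F := (hmeasF.comp measurable_fst).mul
    ((measurable_one.indicator hSm).comp measurable_snd)
  calc _ ≤ ENNReal.ofReal |V.det| * ∫⁻ l : Fin (n + 2) → ℝ,
        F (MeasurableEquiv.piFinSuccAbove (fun _ : Fin (n + 2) => ℝ) 0 l) := by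
        gcongr with l
        exact hpt l
    _ = ENNReal.ofReal |V.det| * ((∫⁻ t, Φ |t * V.det|) * 2 ^ n) := by
        rw [(volume_preserving_piFinSuccAbove (fun _ : Fin (n + 2) => ℝ) 0).lintegral_comp hFm,
          Measure.volume_eq_prod, hF,
          lintegral_prod_mul hmeasF.aemeasurable (measurable_one.indicator hSm).aemeasurable,
          lintegral_indicator_one hSm, volume_half_cube]
    _ = _ := by
        rw [← mul_assoc, lintegral_comp_abs_mul hΦ hV, pow_succ]
        ring

lemma measurable_det_homMatrix_updateRow {d : ℕ} (i : Fin (d + 1)) (u : Fin (d + 1) → ℝ) :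
    Measurable fun P : Fin (d + 1) → EuclideanSpace ℝ (Fin d) =>
      ((homMatrix P).updateRow i u).det :=
  (continuous_det_updateRow continuous_homMatrix continuous_const i).measurable

lemma measurable_det_homMatrix {d : ℕ} :
    Measurable fun P : Fin (d + 1) → EuclideanSpace ℝ (Fin d) => (homMatrix P).det :=
  continuous_homMatrix.matrix_det.measurable

/-- Nondegenerate simplices in `K` in which the facet opposite to vertex `0` has the largest
projection along `u`. -/
def apexSimplices {d : ℕ} (K : Set (EuclideanSpace ℝ (Fin d))) (u : Fin (d + 1) → ℝ) :
    Set (Fin (d + 1) → EuclideanSpace ℝ (Fin d)) :=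
  {P | (homMatrix P).det ≠ 0 ∧ (∀ i, P i ∈ K) ∧ ((homMatrix P).updateRow 0 u).det ≠ 0 ∧
    ∀ i, |((homMatrix P).updateRow i u).det| ≤ |((homMatrix P).updateRow 0 u).det|}

lemma measurableSet_apexSimplices {d : ℕ} {K : Set (EuclideanSpace ℝ (Fin d))}
    (hK : MeasurableSet K) (u : Fin (d + 1) → ℝ) : MeasurableSet (apexSimplices K u) := by
  have : apexSimplices K u = {P | (homMatrix P).det ≠ 0} ∩ ((⋂ i, {P | P i ∈ K}) ∩
      ({P | ((homMatrix P).updateRow 0 u).det ≠ 0} ∩ ⋂ i, {P |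
        |((homMatrix P).updateRow i u).det| ≤ |((homMatrix P).updateRow 0 u).det|})) := by
    ext; simp [apexSimplices]
  rw [this]
  have hne : MeasurableSet {x : ℝ | x ≠ 0} := (measurableSet_singleton 0).compl
  refine (measurable_det_homMatrix hne).inter ((MeasurableSet.iInter fun i => ?_).inter
    ((measurable_det_homMatrix_updateRow 0 u hne).inter (MeasurableSet.iInter fun i => ?_)))
  · exact measurable_pi_apply i hK
  · exact measurableSet_le (measurable_det_homMatrix_updateRow i u).abs
      (measurable_det_homMatrix_updateRow 0 u).abs

/-- Configurations consisting of an apex simplex, `m` points not enlarging it and `r` points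
outside of it. -/
def emptyConfigurations {d : ℕ} (K : Set (EuclideanSpace ℝ (Fin d))) (u : Fin (d + 1) → ℝ)
    (m r : ℕ) : Set ((Fin (d + 1) → EuclideanSpace ℝ (Fin d)) ×
      ((Fin m → EuclideanSpace ℝ (Fin d)) × (Fin r → EuclideanSpace ℝ (Fin d)))) :=
  {x | x.1 ∈ apexSimplices K u ∧ (∀ j, x.2.1 j ∈ notEnlarging x.1) ∧
    ∀ j, x.2.2 j ∉ openSimplex x.1}

lemma measurableSet_emptyConfigurations {d : ℕ} {K : Set (EuclideanSpace ℝ (Fin d))}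
    (hK : MeasurableSet K) (u : Fin (d + 1) → ℝ) (m r : ℕ) :
    MeasurableSet (emptyConfigurations K u m r) := by
  have h : ∀ i : Fin (d + 1), Measurable fun x : (Fin (d + 1) → EuclideanSpace ℝ (Fin d)) ×
      EuclideanSpace ℝ (Fin d) => ((homMatrix x.1).updateRow i (homCoord x.2)).det := fun i =>
    (continuous_det_updateRow (continuous_homMatrix.comp continuous_fst)
      (continuous_homCoord.comp continuous_snd) i).measurable
  have hdet : Measurable fun x : (Fin (d + 1) → EuclideanSpace ℝ (Fin d)) ×
      EuclideanSpace ℝ (Fin d) => (homMatrix x.1).det :=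
    measurable_det_homMatrix.comp measurable_fst
  have hN : MeasurableSet {x : (Fin (d + 1) → EuclideanSpace ℝ (Fin d)) ×
      EuclideanSpace ℝ (Fin d) | x.2 ∈ notEnlarging x.1} := by
    simp only [notEnlarging, Set.mem_ofPred_eq]
    rw [Set.ofPred_forall]
    exact MeasurableSet.iInter fun i => measurableSet_le (h i).abs hdet.abs
  have hO : MeasurableSet {x : (Fin (d + 1) → EuclideanSpace ℝ (Fin d)) ×
      EuclideanSpace ℝ (Fin d) | x.2 ∈ openSimplex x.1} := by
    simp only [openSimplex, Set.mem_ofPred_eq]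
    rw [Set.ofPred_forall]
    exact MeasurableSet.iInter fun i => measurableSet_lt measurable_const ((h i).div hdet)
  have : emptyConfigurations K u m r = (Prod.fst ⁻¹' apexSimplices K u) ∩
      ((⋂ j, (fun x => (x.1, x.2.1 j)) ⁻¹' {x | x.2 ∈ notEnlarging x.1}) ∩
        ⋂ j, (fun x => (x.1, x.2.2 j)) ⁻¹' {x | x.2 ∈ openSimplex x.1}ᶜ) := by
    ext; simp [emptyConfigurations]
  rw [this]
  refine (measurable_fst (measurableSet_apexSimplices hK u)).inter
    ((MeasurableSet.iInter fun j => ?_).inter (MeasurableSet.iInter fun j => ?_))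
  · exact (by fun_prop : Measurable fun x : (Fin (d + 1) → EuclideanSpace ℝ (Fin d)) ×
      ((Fin m → EuclideanSpace ℝ (Fin d)) × (Fin r → EuclideanSpace ℝ (Fin d))) =>
      (x.1, x.2.1 j)) hN
  · exact (by fun_prop : Measurable fun x : (Fin (d + 1) → EuclideanSpace ℝ (Fin d)) ×
      ((Fin m → EuclideanSpace ℝ (Fin d)) × (Fin r → EuclideanSpace ℝ (Fin d))) =>
      (x.1, x.2.2 j)) hO.compl

lemma det_le_factorial_of_subset {d : ℕ} {K : Set (EuclideanSpace ℝ (Fin d))}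
    (hKc : Convex ℝ K) (hK1 : volume K = 1) {P : Fin (d + 1) → EuclideanSpace ℝ (Fin d)}
    (hP : (homMatrix P).det ≠ 0) (hPK : ∀ i, P i ∈ K) :
    openSimplex P ⊆ K ∧ |(homMatrix P).det| ≤ d.factorial := by
  have hsub : openSimplex P ⊆ K := (openSimplex_subset_convexHull hP).trans
    (convexHull_min (Set.range_subset_iff.2 hPK) hKc)
  refine ⟨hsub, ?_⟩
  have h := measure_mono (μ := volume) hsub
  rw [volume_openSimplex hP, hK1, ENNReal.ofReal_le_one, div_le_one (by positivity)] at h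
  exact h

/-- The probability that the extra points of a configuration with a given apex simplex are
admissible. -/
lemma measure_section_emptyConfigurations_le {d : ℕ} {K : Set (EuclideanSpace ℝ (Fin d))}
    (hKc : Convex ℝ K) (hK1 : volume K = 1) (u : Fin (d + 1) → ℝ)
    (m r : ℕ) (P : Fin (d + 1) → EuclideanSpace ℝ (Fin d)) :
    ((Measure.pi fun _ : Fin m => volume.restrict K).prod
      (Measure.pi fun _ : Fin r => volume.restrict K))
        (Prod.mk P ⁻¹' emptyConfigurations K u m r)
      ≤ (apexSimplices K u).indicator
        (fun P => simplexWeight d.factorial (2 ^ d) m r |(homMatrix P).det|) P := by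
  by_cases hP : P ∈ apexSimplices K u
  swap
  · have : Prod.mk P ⁻¹' emptyConfigurations K u m r = ∅ := by
      ext x; simp [emptyConfigurations, hP]
    rw [this, measure_empty]
    exact zero_le
  rw [Set.indicator_of_mem hP]
  obtain ⟨hsub, hle⟩ := det_le_factorial_of_subset hKc hK1 hP.1 hP.2.1
  have hsec : Prod.mk P ⁻¹' emptyConfigurations K u m r
      ⊆ (Set.univ.pi fun _ => notEnlarging P) ×ˢ (Set.univ.pi fun _ => (openSimplex P)ᶜ) := by
    rintro x ⟨-, h1, h2⟩
    exact ⟨fun j _ => h1 j, fun j _ => h2 j⟩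
  have hq : (volume.restrict K) (notEnlarging P)
      ≤ ENNReal.ofReal (2 ^ d * |(homMatrix P).det|) :=
    (Measure.restrict_apply_le _ _).trans (volume_notEnlarging_le hP.1)
  have hom := (isOpen_openSimplex P).measurableSet
  -- The simplex lies in `K` and `K` has volume 1, so the mass outside it is known exactly.
  have hr : (volume.restrict K) (openSimplex P)ᶜ
      ≤ ENNReal.ofReal (1 - |(homMatrix P).det| / d.factorial) := by
    rw [Measure.restrict_apply hom.compl, Set.inter_comm, ← Set.sdiff_eq,
      measure_sdiff hsub hom.nullMeasurableSet
        ((measure_mono hsub).trans_lt (by rw [hK1]; exact ENNReal.one_lt_top)).ne,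
      volume_openSimplex hP.1, hK1, ENNReal.ofReal_sub _ (by positivity), ENNReal.ofReal_one]
  have h1 : 0 ≤ 1 - |(homMatrix P).det| / d.factorial := by
    rw [sub_nonneg, div_le_one (by positivity)]
    exact hle
  calc _ ≤ _ := measure_mono hsec
    _ = (volume.restrict K) (notEnlarging P) ^ m * (volume.restrict K) (openSimplex P)ᶜ ^ r := by
      rw [Measure.prod_prod, Measure.pi_pi, Measure.pi_pi]
      simp
    _ ≤ ENNReal.ofReal (2 ^ d * |(homMatrix P).det|) ^ m *
        ENNReal.ofReal (1 - |(homMatrix P).det| / d.factorial) ^ r := by gcongr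
    _ = _ := by
      rw [simplexWeight, Set.indicator_of_mem (by exact hle),
        ENNReal.ofReal_mul (pow_nonneg (mul_nonneg (by positivity) (abs_nonneg _)) _),
        ENNReal.ofReal_pow (mul_nonneg (by positivity) (abs_nonneg _)), ENNReal.ofReal_pow h1]

/-- The inner integral runs over the apex with the base facet fixed. Its bound does not depend on
the facet, and the facet is integrated against a probability measure. -/
lemma lintegral_apexSimplices_le {n : ℕ} {K : Set (EuclideanSpace ℝ (Fin (n + 2)))}
    (hKm : MeasurableSet K) (hK1 : volume K = 1) {u : Fin (n + 3) → ℝ} (hu : u 0 = 0)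
    {Φ : ℝ → ENNReal} (hΦ : Measurable Φ) :
    ∫⁻ P, (apexSimplices K u).indicator (fun P => Φ |(homMatrix P).det|) P
        ∂(Measure.pi fun _ : Fin (n + 3) => volume.restrict K)
      ≤ 2 ^ (n + 1) * ∫⁻ t in Set.Ioi 0, Φ t := by
  have : IsProbabilityMeasure (volume.restrict K) := ⟨by simpa using hK1⟩
  set G : (Fin (n + 3) → EuclideanSpace ℝ (Fin (n + 2))) → ENNReal :=
    (apexSimplices K u).indicator (fun P => Φ |(homMatrix P).det|) with hG
  have hGm : Measurable G :=
    (hΦ.comp measurable_det_homMatrix.abs).indicator (measurableSet_apexSimplices hKm u)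
  have hmp := (measurePreserving_piFinSuccAbove
    (fun _ : Fin (n + 3) => (volume.restrict K : Measure (EuclideanSpace ℝ (Fin (n + 2)))))
      0).symm
  have hGm' : Measurable fun z => G ((MeasurableEquiv.piFinSuccAbove
      (fun _ : Fin (n + 3) => EuclideanSpace ℝ (Fin (n + 2))) 0).symm z) :=
    hGm.comp hmp.measurable
  rw [← hmp.lintegral_comp hGm, lintegral_prod_symm _ hGm'.aemeasurable]
  refine (lintegral_mono (g := fun _ => 2 ^ (n + 1) * ∫⁻ t in Set.Ioi 0, Φ t) fun a => ?_).trans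
    (by simp)
  -- The apex is integrated over the whole space: the projection condition and `Φ` alone suffice,
  -- which is why the bound is independent of `K`.
  refine (lintegral_mono' Measure.restrict_le_self le_rfl).trans ?_
  set V : Matrix (Fin (n + 3)) (Fin (n + 3)) ℝ :=
    Matrix.of (Fin.cons u fun j => homCoord (a j)) with hV
  have hP : ∀ p, (MeasurableEquiv.piFinSuccAbove
      (fun _ : Fin (n + 3) => EuclideanSpace ℝ (Fin (n + 2))) 0).symm (p, a)
        = (Fin.cons p a : Fin (n + 3) → EuclideanSpace ℝ (Fin (n + 2))) := fun p => by
    funext i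
    exact Fin.cases rfl (fun _ => rfl) i
  have hH : ∀ p, homMatrix (Fin.cons p a : Fin (n + 3) → EuclideanSpace ℝ (Fin (n + 2)))
      = V.updateRow 0 (homCoord p) := by
    intro p
    ext i j
    refine Fin.cases ?_ (fun i => ?_) i
    · simp [homMatrix]
    · simp [homMatrix, hV, Matrix.updateRow_apply]
  have hVu : ∀ p, (V.updateRow 0 (homCoord p)).updateRow 0 u = V := by
    intro p
    ext i j
    refine Fin.cases ?_ (fun i => ?_) i
    · simp [hV]
    · simp [hV, Matrix.updateRow_apply]
  have hVu' : V.updateRow 0 u = V := by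
    ext i j
    refine Fin.cases ?_ (fun i => ?_) i
    · simp [hV]
    · simp [hV, Matrix.updateRow_apply]
  -- A base facet parallel to the direction or degenerate has projection 0, which `apexSimplices`
  -- excludes.
  by_cases hdet : V.det = 0
  · have : ∀ p, G ((MeasurableEquiv.piFinSuccAbove
      (fun _ : Fin (n + 3) => EuclideanSpace ℝ (Fin (n + 2))) 0).symm (p, a)) = 0 := by
      intro p
      rw [hP, hG, Set.indicator_of_notMem]
      rintro ⟨-, -, h, -⟩
      rw [hH, hVu] at h
      exact h hdet
    rw [lintegral_congr this]
    simp
  refine le_trans ?_ (setLIntegral_apex_le (V := V) (by simpa [hV] using hu)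
    (fun i => by simp [hV]) hdet hΦ)
  rw [← lintegral_indicator]
  · refine lintegral_mono fun p => ?_
    simp only
    rw [hP, hG]
    refine Set.indicator_apply_le' (fun hp => ?_) fun _ => zero_le
    rw [Set.indicator_of_mem, hH]
    intro i
    -- Exchanging the roles of `u` and `p` turns the comparison of projected facets into a bound on
    -- the Cramer determinants of `p` in the frame `V`.
    have := hp.2.2.2 i.succ
    rw [hH, hVu, abs_det_updateRow_comm V (Fin.succ_ne_zero i).symm, hVu'] at this
    exact this
  · rw [Set.ofPred_forall]
    exact MeasurableSet.iInter fun i => measurableSet_le (continuous_det_updateRow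
      continuous_const continuous_homCoord i.succ).measurable.abs measurable_const

lemma measure_emptyConfigurations_le {n : ℕ} {K : Set (EuclideanSpace ℝ (Fin (n + 2)))}
    (hKm : MeasurableSet K) (hKc : Convex ℝ K) (hK1 : volume K = 1) {u : Fin (n + 3) → ℝ}
    (hu : u 0 = 0) (m r : ℕ) :
    ((Measure.pi fun _ : Fin (n + 3) => volume.restrict K).prod
      ((Measure.pi fun _ : Fin m => volume.restrict K).prod
        (Measure.pi fun _ : Fin r => volume.restrict K))) (emptyConfigurations K u m r)
      ≤ ENNReal.ofReal (2 ^ (n + 1) * ((n + 2).factorial * (2 ^ (n + 2) * (n + 2).factorial) ^ m *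
        (m.factorial / ((r : ℝ) + 1) ^ (m + 1)))) := by
  have : IsProbabilityMeasure (volume.restrict K) := ⟨by simpa using hK1⟩
  rw [Measure.prod_apply (measurableSet_emptyConfigurations hKm u m r)]
  refine (lintegral_mono (measure_section_emptyConfigurations_le hKc hK1 u m r)).trans ?_
  refine (lintegral_apexSimplices_le hKm hK1 hu (measurable_simplexWeight _ _ m r)).trans ?_
  rw [ENNReal.ofReal_mul (by positivity), ENNReal.ofReal_pow zero_le_two, ENNReal.ofReal_ofNat]
  gcongr
  exact lintegral_simplexWeight_le (by positivity) (by positivity) m r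

/-! ### Measurability of hole events -/

lemma mem_convexHull_range_iff {ι E : Type*} [Fintype ι] [AddCommGroup E] [Module ℝ E] (v : ι → E)
    (p : E) : p ∈ convexHull ℝ (Set.range v) ↔ ∃ w ∈ stdSimplex ℝ ι, ∑ i, w i • v i = p := by
  classical
  have h : Set.range v = Fintype.linearCombination ℝ v ''
      (Set.range fun i j : ι => if i = j then (1 : ℝ) else 0) := by
    rw [← Set.range_comp]
    congr 1
    ext i
    simp [Fintype.linearCombination_apply]
  rw [h, ← LinearMap.image_convexHull, convexHull_basis_eq_stdSimplex]
  simp [Fintype.linearCombination_apply]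

/-- The set is the projection of a closed incidence relation along the compact simplex of weights.
-/
lemma isClosed_mem_convexHull_range {ι E : Type*} [Fintype ι] [NormedAddCommGroup E]
    [NormedSpace ℝ E] :
    IsClosed {x : (ι → E) × E | x.2 ∈ convexHull ℝ (Set.range x.1)} := by
  have : CompactSpace (stdSimplex ℝ ι) := isCompact_iff_compactSpace.1 (isCompact_stdSimplex ℝ ι)
  have h : {x : (ι → E) × E | x.2 ∈ convexHull ℝ (Set.range x.1)}
      = Prod.snd '' {y : stdSimplex ℝ ι × ((ι → E) × E) | ∑ i, y.1.1 i • y.2.1 i = y.2.2} := by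
    ext x
    simp only [Set.mem_ofPred_eq, mem_convexHull_range_iff, Set.mem_image]
    constructor
    · rintro ⟨w, hw, h⟩
      exact ⟨(⟨w, hw⟩, x), h, rfl⟩
    · rintro ⟨⟨w, y⟩, h, rfl⟩
      exact ⟨w.1, w.2, h⟩
  rw [h]
  refine isClosedMap_snd_of_compactSpace _ (isClosed_eq ?_ (by fun_prop))
  refine continuous_finsetSum _ fun i _ => Continuous.smul ?_ (by fun_prop)
  exact (continuous_apply i).comp (continuous_subtype_val.comp continuous_fst)

lemma measurableSet_mem_convexHull {ι E : Type*} [Fintype ι] [NormedAddCommGroup E]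
    [NormedSpace ℝ E] [FiniteDimensional ℝ E] [MeasurableSpace E] [BorelSpace E]
    (I : Set ι) (l : ι) (v : E) :
    MeasurableSet {x : ι → E | x l + v ∈ convexHull ℝ (x '' I)} := by
  classical
  have hc : Continuous fun x : ι → E => ((fun i : I => x i, x l + v) : (I → E) × E) := by
    fun_prop
  have h := isClosed_mem_convexHull_range.preimage hc
  have : {x : ι → E | x l + v ∈ convexHull ℝ (x '' I)} = (fun x : ι → E =>
      ((fun i : I => x i, x l + v) : (I → E) × E)) ⁻¹'
        {x : (I → E) × E | x.2 ∈ convexHull ℝ (Set.range x.1)} := by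
    ext x
    simp [Set.image_eq_range]
  rw [this]
  have : ProperSpace E := FiniteDimensional.proper_real E
  exact h.measurableSet

/-- Being an interior point of a closed set can be tested on a dense sequence of translations. -/
lemma mem_interior_iff_denseSeq {E : Type*} [NormedAddCommGroup E]
    [TopologicalSpace.SeparableSpace E] {C : Set E} (hC : IsClosed C) (p : E) :
    p ∈ interior C ↔ ∃ N : ℕ, ∀ i : ℕ,
      ‖TopologicalSpace.denseSeq E i‖ < 1 / ((N : ℝ) + 1) → p + TopologicalSpace.denseSeq E i ∈ C := by
  rw [mem_interior_iff_mem_nhds, Metric.mem_nhds_iff]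
  constructor
  · rintro ⟨ε, hε, h⟩
    obtain ⟨N, hN⟩ := exists_nat_one_div_lt hε
    refine ⟨N, fun i hi => h ?_⟩
    rw [Metric.mem_ball, dist_eq_norm, add_sub_cancel_left]
    exact hi.trans hN
  · rintro ⟨N, hN⟩
    refine ⟨1 / ((N : ℝ) + 1), by positivity, fun y hy => ?_⟩
    set U : Set E := Metric.ball 0 (1 / ((N : ℝ) + 1))
    have hd : U ⊆ closure (U ∩ Set.range (TopologicalSpace.denseSeq E)) :=
      (TopologicalSpace.denseRange_denseSeq E).open_subset_closure_inter Metric.isOpen_ball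
    have hyU : y - p ∈ U := by
      rw [Metric.mem_ball, dist_eq_norm] at hy
      simpa [U] using hy
    have hcl : IsClosed ((fun v => p + v) ⁻¹' C) := hC.preimage (by fun_prop)
    have hsub : closure (U ∩ Set.range (TopologicalSpace.denseSeq E)) ⊆ (fun v => p + v) ⁻¹' C := by
      refine closure_minimal ?_ hcl
      rintro _ ⟨h1, i, rfl⟩
      exact hN i (by simpa [U] using h1)
    simpa using hsub (hd hyU)

/-- The event that the points with indices in `I` are in convex position and that the interior of
their convex hull contains no point. -/
def holeEvent {ι E : Type*} [NormedAddCommGroup E] [NormedSpace ℝ E] (I : Set ι) : Set (ι → E) :=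
  {x | (∀ i ∈ I, x i ∉ convexHull ℝ (x '' (I \ {i}))) ∧
    ∀ l, x l ∉ interior (convexHull ℝ (x '' I))}

/-- Hulls of finitely many points are closed, so interior membership becomes a countable combination
of closed conditions on translated points; the translation by 0 brings the convex position
conditions to the same form. -/
lemma measurableSet_holeEvent {ι E : Type*} [Fintype ι] [NormedAddCommGroup E]
    [NormedSpace ℝ E] [FiniteDimensional ℝ E] [MeasurableSpace E] [BorelSpace E] (I : Set ι) :
    MeasurableSet (holeEvent I : Set (ι → E)) := by
  have : ProperSpace E := FiniteDimensional.proper_real E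
  have h : (holeEvent I : Set (ι → E)) =
      (⋂ i ∈ I, {x : ι → E | x i + 0 ∈ convexHull ℝ (x '' (I \ {i}))}ᶜ) ∩
      ⋂ l, (⋃ N : ℕ, ⋂ i : ℕ, ⋂ _ : ‖TopologicalSpace.denseSeq E i‖ < 1 / ((N : ℝ) + 1),
        {x : ι → E | x l + TopologicalSpace.denseSeq E i ∈ convexHull ℝ (x '' I)})ᶜ := by
    ext x
    have hC : IsClosed (convexHull ℝ (x '' I)) := (Set.toFinite _).isClosed_convexHull ℝ
    simp [holeEvent, mem_interior_iff_denseSeq hC]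
  rw [h]
  refine (MeasurableSet.biInter (Set.to_countable I) fun i _ =>
    (measurableSet_mem_convexHull _ _ _).compl).inter (MeasurableSet.iInter fun l => ?_)
  exact (MeasurableSet.iUnion fun N => MeasurableSet.iInter fun i => MeasurableSet.iInter fun _ =>
    measurableSet_mem_convexHull _ _ _).compl

/-! ### General position -/

/-- Almost every configuration is in general position. -/
lemma ae_det_homMatrix_ne_zero {d n : ℕ} {f : Fin (d + 1) → Fin n} (hf : Function.Injective f) :
    ∀ᵐ x : Fin n → EuclideanSpace ℝ (Fin d), (homMatrix (x ∘ f)).det ≠ 0 := by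
  classical
  set s : Set (Fin n → EuclideanSpace ℝ (Fin d)) := {x | (homMatrix (x ∘ f)).det ≠ 0}
  have hs : MeasurableSet s := by
    have : Measurable fun x : Fin n → EuclideanSpace ℝ (Fin d) => (homMatrix (x ∘ f)).det :=
      measurable_det_homMatrix.comp
        (measurable_pi_lambda _ fun i => measurable_pi_apply (f i))
    exact this (measurableSet_singleton 0).compl
  -- Moving along `y` fixes vertex 0 and shifts vertex j + 1 by the j-th unit vector, so the edge
  -- matrix becomes B + t·1. Its determinant is the characteristic polynomial of -B at t, which has
  -- finitely many roots; null sets can be tested along such lines.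
  set y : Fin n → EuclideanSpace ℝ (Fin d) :=
    fun l => ∑ j : Fin d, if f j.succ = l then EuclideanSpace.single j (1 : ℝ) else 0 with hy
  have hy0 : y (f 0) = 0 := by
    simp [hy, hf.eq_iff, Fin.succ_ne_zero]
  have hys : ∀ j : Fin d, y (f j.succ) = EuclideanSpace.single j (1 : ℝ) := by
    intro j
    simp [hy, hf.eq_iff]
  refine ae_mem_of_ae_add_linearMap_mem (LinearMap.toSpanSingleton ℝ _ y) volume volume hs
    fun x => ?_
  set B := edgeMatrix (homMatrix (x ∘ f)) 0
  have hedge : ∀ t : ℝ, edgeMatrix (homMatrix ((x + t • y) ∘ f)) 0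
      = Matrix.scalar _ t - (-B) := by
    intro t
    ext i j
    simp only [edgeMatrix, homMatrix, Matrix.of_apply, Fin.zero_succAbove, homCoord_zero,
      homCoord_succ, Function.comp_apply, Pi.add_apply, Pi.smul_apply, PiLp.add_apply,
      PiLp.smul_apply, hy0, hys, B, Matrix.sub_apply, Matrix.neg_apply, Matrix.scalar_apply,
      Matrix.diagonal_apply, PiLp.single_apply, smul_eq_mul]
    by_cases hij : i = j
    · subst hij; simp; ring
    · simp [hij, Ne.symm hij]
  have hfin : {t : ℝ | (-B).charpoly.IsRoot t}.Finite :=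
    Polynomial.finite_setOfPred_isRoot (Matrix.charpoly_monic _).ne_zero
  filter_upwards [hfin.countable.ae_notMem volume] with t ht hzero
  apply ht
  change (-B).charpoly.eval t = 0
  rw [Matrix.eval_charpoly, ← hedge]
  have := abs_det_edgeMatrix (homMatrix ((x + t • y) ∘ f)) 0 rfl
  have hz : (homMatrix ((x + t • y) ∘ f)).det = 0 := hzero
  rw [hz, abs_zero] at this
  exact abs_eq_zero.1 this

/-! ### From holes to labelled configurations -/

lemma measurePreserving_splitSum {α β γ δ E : Type*} [Fintype α] [Fintype β] [Fintype γ]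
    [Fintype δ] [MeasurableSpace E] (ρ : Measure E) [SigmaFinite ρ] (e : α ⊕ (β ⊕ γ) ≃ δ) :
    MeasurePreserving (fun x : δ → E => ((fun i => x (e (Sum.inl i)),
        (fun i => x (e (Sum.inr (Sum.inl i))), fun i => x (e (Sum.inr (Sum.inr i))))) :
        (α → E) × ((β → E) × (γ → E))))
      (Measure.pi fun _ => ρ)
      ((Measure.pi fun _ => ρ).prod ((Measure.pi fun _ => ρ).prod (Measure.pi fun _ => ρ))) := by
  have h1 := (measurePreserving_piCongrLeft (fun _ : δ => ρ) e).symm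
  have h2 := measurePreserving_sumPiEquivProdPi (X := fun _ : α ⊕ (β ⊕ γ) => E) fun _ => ρ
  have h3 := measurePreserving_sumPiEquivProdPi (X := fun _ : β ⊕ γ => E) fun _ => ρ
  have h4 := (MeasurePreserving.id (Measure.pi fun _ : α => ρ)).prod h3
  exact (h4.comp h2).comp h1

/-- Labelling of `n` indices according to a `d`-set, a further index, the rest of a set containing
both, and the complement. -/
lemma exists_labelling {d m r n : ℕ} {I D : Finset (Fin n)} {j : Fin n} (hDI : D ⊆ I)
    (hD : D.card = d) (hj : j ∈ I \ D) (hI : I.card = d + 1 + m) (hn : n = d + 1 + m + r) :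
    ∃ e : Fin (d + 1) ⊕ (Fin m ⊕ Fin r) ≃ Fin n, e (Sum.inl 0) = j ∧
      (∀ i : Fin d, e (Sum.inl i.succ) ∈ D) ∧ ∀ i, e (Sum.inr (Sum.inl i)) ∈ I := by
  obtain ⟨hjI, hjD⟩ := Finset.mem_sdiff.1 hj
  have hR : ((I \ D).erase j).card = m := by
    rw [Finset.card_erase_of_mem hj, Finset.card_sdiff_of_subset hDI]; omega
  have hC : (Iᶜ).card = r := by
    rw [Finset.card_compl, Fintype.card_fin]; omega
  set b := ((I \ D).erase j).orderEmbOfFin hR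
  set c := (Iᶜ).orderEmbOfFin hC
  set a := D.orderEmbOfFin hD
  have ha : ∀ i, a i ∈ D := fun i => Finset.orderEmbOfFin_mem _ _ i
  have hb : ∀ i, b i ∈ (I \ D).erase j := fun i => Finset.orderEmbOfFin_mem _ _ i
  have hc : ∀ i, c i ∉ I := fun i => Finset.mem_compl.1 (Finset.orderEmbOfFin_mem _ _ i)
  have hb1 : ∀ i, b i ≠ j := fun i => (Finset.mem_erase.1 (hb i)).1
  have hb2 : ∀ i, b i ∈ I ∧ b i ∉ D := fun i =>
    Finset.mem_sdiff.1 (Finset.mem_erase.1 (hb i)).2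
  have hinj : Function.Injective (Sum.elim (Fin.cons j a : Fin (d + 1) → Fin n) (Sum.elim b c)) := by
    refine Function.Injective.sumElim ?_ (b.injective.sumElim c.injective ?_) ?_
    · rw [Fin.cons_injective_iff]
      exact ⟨by rintro ⟨i, rfl⟩; exact hjD (ha i), a.injective⟩
    · intro i i' h
      exact hc i' (h ▸ (hb2 i).1)
    · intro i i'
      refine Fin.cases ?_ (fun i => ?_) i
      · rcases i' with i' | i'
        · exact (hb1 i').symm
        · intro h
          simp only [Fin.cons_zero, Sum.elim_inr] at h
          exact hc i' (h ▸ hjI)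
      · rcases i' with i' | i'
        · intro h
          simp only [Fin.cons_succ, Sum.elim_inl] at h
          exact (hb2 i').2 (h ▸ ha i)
        · intro h
          simp only [Fin.cons_succ, Sum.elim_inr] at h
          exact hc i' (h ▸ hDI (ha i))
  have hbij := (Fintype.bijective_iff_injective_and_card _).2 ⟨hinj, by
    simp only [Fintype.card_sum, Fintype.card_fin]; omega⟩
  refine ⟨Equiv.ofBijective _ hbij, rfl, fun i => ?_, fun i => ?_⟩
  · simpa using ha i
  · simpa using (hb2 i).1

/-- In general position, every index set with at least `d + 1` elements contains a simplex of
maximal volume, whose vertices can be numbered such that the facet opposite to vertex `0` has the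
largest projection along `u`. -/
lemma exists_maximal_simplex {d n : ℕ} {x : Fin n → EuclideanSpace ℝ (Fin d)}
    (hx : ∀ f : Fin (d + 1) → Fin n, Function.Injective f → (homMatrix (x ∘ f)).det ≠ 0)
    {u : Fin (d + 1) → ℝ} (hu : u ≠ 0) {I : Finset (Fin n)} (hI : d + 1 ≤ I.card) :
    ∃ g : Fin (d + 1) → Fin n, Function.Injective g ∧ (∀ i, g i ∈ I) ∧
      (∀ h : Fin (d + 1) → Fin n, (∀ i, h i ∈ I) →
        |(homMatrix (x ∘ h)).det| ≤ |(homMatrix (x ∘ g)).det|) ∧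
      ((homMatrix (x ∘ g)).updateRow 0 u).det ≠ 0 ∧
      ∀ i, |((homMatrix (x ∘ g)).updateRow i u).det|
        ≤ |((homMatrix (x ∘ g)).updateRow 0 u).det| := by
  classical
  obtain ⟨s, hsI, hs⟩ := Finset.exists_subset_card_eq hI
  set f₀ := s.orderEmbOfFin hs
  have hf₀ : ∀ i, f₀ i ∈ I := fun i => hsI (Finset.orderEmbOfFin_mem _ _ i)
  have : Nonempty (Fin (d + 1) → I) := ⟨fun i => ⟨f₀ i, hf₀ i⟩⟩
  -- The maximum runs over all index tuples. Repeated indices give determinant 0, so general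
  -- position makes the maximizer injective.
  obtain ⟨f, hf⟩ := Finite.exists_max fun h : Fin (d + 1) → I =>
    |(homMatrix (x ∘ fun i => (h i : Fin n))).det|
  set f' : Fin (d + 1) → Fin n := fun i => f i with hf'
  have hmax : ∀ h : Fin (d + 1) → Fin n, (∀ i, h i ∈ I) →
      |(homMatrix (x ∘ h)).det| ≤ |(homMatrix (x ∘ f')).det| :=
    fun h hh => hf fun i => ⟨h i, hh i⟩
  have hdet : (homMatrix (x ∘ f')).det ≠ 0 := by
    intro h0
    have h1 := hmax f₀ hf₀
    rw [h0, abs_zero] at h1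
    exact hx f₀ f₀.injective (abs_nonpos_iff.1 h1)
  have hinj : Function.Injective f' := by
    intro a b hab
    by_contra hne
    exact hdet (Matrix.det_zero_of_row_eq hne (by
      ext j; simp only [homMatrix, Matrix.of_apply, Function.comp_apply, hab]))
  -- The vertex opposite the largest projected facet is swapped into position 0; some projection is
  -- nonzero because `u` is.
  obtain ⟨a, ha⟩ := Finite.exists_max fun i => |((homMatrix (x ∘ f')).updateRow i u).det|
  obtain ⟨b, hb⟩ := exists_det_updateRow_ne_zero hdet hu
  have hσ : homMatrix (x ∘ f' ∘ Equiv.swap 0 a)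
      = (homMatrix (x ∘ f')).submatrix (Equiv.swap 0 a) id := rfl
  refine ⟨f' ∘ Equiv.swap 0 a, hinj.comp (Equiv.injective _), fun i => (f _).2, ?_, ?_, ?_⟩
  · intro h hh
    rw [hσ, abs_det_submatrix_perm]
    exact hmax h hh
  · rw [← abs_pos, hσ, abs_det_updateRow_submatrix, Equiv.swap_apply_left]
    exact (abs_pos.2 hb).trans_le (ha b)
  · intro i
    rw [hσ, abs_det_updateRow_submatrix, abs_det_updateRow_submatrix, Equiv.swap_apply_left]
    exact ha _

/-- `D` indexes the base facet of the maximal simplex and `j` its apex. The conditions do not depend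
on the order within `D` or among the remaining hole points, so every labelling compatible with the
pair works and the union bound need only range over pairs. -/
lemma mem_emptyConfigurations_of_mem_holeEvent {d n m r : ℕ}
    {K : Set (EuclideanSpace ℝ (Fin d))} {x : Fin n → EuclideanSpace ℝ (Fin d)}
    (hx : ∀ f : Fin (d + 1) → Fin n, Function.Injective f → (homMatrix (x ∘ f)).det ≠ 0)
    (hxK : ∀ i, x i ∈ K) {u : Fin (d + 1) → ℝ} (hu : u ≠ 0) {I : Finset (Fin n)}
    (hI : d + 1 ≤ I.card) (hole : x ∈ holeEvent (I : Set (Fin n))) :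
    ∃ D ∈ Finset.powersetCard d I, ∃ j ∈ I \ D,
      ∀ e : Fin (d + 1) ⊕ (Fin m ⊕ Fin r) ≃ Fin n, e (Sum.inl 0) = j →
      (∀ i : Fin d, e (Sum.inl i.succ) ∈ D) → (∀ i, e (Sum.inr (Sum.inl i)) ∈ I) →
      ((fun i => x (e (Sum.inl i)),
        (fun i => x (e (Sum.inr (Sum.inl i))), fun i => x (e (Sum.inr (Sum.inr i)))))) ∈
        emptyConfigurations K u m r := by
  classical
  obtain ⟨g, hg, hgI, hmax, hg0, hga⟩ := exists_maximal_simplex hx hu hI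
  refine ⟨Finset.univ.image fun i : Fin d => g i.succ, ?_, g 0, ?_, ?_⟩
  · rw [Finset.mem_powersetCard]
    refine ⟨fun l hl => ?_, ?_⟩
    · obtain ⟨i, -, rfl⟩ := Finset.mem_image.1 hl
      exact hgI _
    · rw [Finset.card_image_of_injective _ fun a b h => Fin.succ_injective _ (hg h), Finset.card_univ,
        Fintype.card_fin]
  · simp only [Finset.mem_sdiff, hgI, Finset.mem_image, Finset.mem_univ, true_and, not_exists]
    exact fun i h => Fin.succ_ne_zero i (hg h)
  intro e he0 heD heI
  have hex : ∀ i, ∃ a, g a = e (Sum.inl i) := by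
    intro i
    refine Fin.cases ⟨0, he0.symm⟩ (fun i => ?_) i
    obtain ⟨a, -, h⟩ := Finset.mem_image.1 (heD i)
    exact ⟨a.succ, h⟩
  choose s hs using hex
  have hsinj : Function.Injective s := fun a b hab => by
    have := (hs a).symm.trans ((congrArg g hab).trans (hs b))
    exact Sum.inl_injective (e.injective this)
  -- The labelling runs through the same vertices up to a permutation fixing the apex, which
  -- preserves all absolute determinants involved.
  set σ : Equiv.Perm (Fin (d + 1)) := Equiv.ofBijective s
    (Finite.injective_iff_bijective.1 hsinj)
  have hσ0 : σ 0 = 0 := hg ((hs 0).trans he0)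
  set g' : Fin (d + 1) → Fin n := fun i => e (Sum.inl i) with hg'
  have hgσ : g' = g ∘ σ := funext fun i => (hs i).symm
  have hg'inj : Function.Injective g' := e.injective.comp Sum.inl_injective
  have hg'I : ∀ i, g' i ∈ I := fun i => by rw [hgσ]; exact hgI _
  have hM : homMatrix (x ∘ g') = (homMatrix (x ∘ g)).submatrix σ id := by rw [hgσ]; rfl
  have hdet := hx g' hg'inj
  refine ⟨⟨hdet, fun i => hxK _, ?_, fun i => ?_⟩, fun i => ?_, fun i => ?_⟩
  · change ((homMatrix (x ∘ g')).updateRow 0 u).det ≠ 0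
    rw [← abs_pos, hM, abs_det_updateRow_submatrix, hσ0]
    exact abs_pos.2 hg0
  · change |((homMatrix (x ∘ g')).updateRow i u).det| ≤ |((homMatrix (x ∘ g')).updateRow 0 u).det|
    rw [hM, abs_det_updateRow_submatrix, abs_det_updateRow_submatrix, hσ0]
    exact hga _
  · intro a
    change |((homMatrix (x ∘ g')).updateRow a _).det| ≤ |(homMatrix (x ∘ g')).det|
    -- Replacing a vertex by a hole point gives another index tuple in `I`, to which maximality
    -- applies.
    rw [← homMatrix_update, hM, abs_det_submatrix_perm, ← Function.comp_update]
    refine hmax _ fun b => ?_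
    by_cases hba : b = a
    · subst hba; simpa using heI i
    · rw [Function.update_of_ne hba]; exact hg'I b
  · intro hmem
    refine hole.2 (e (Sum.inr (Sum.inr i))) (interior_maximal ?_ (isOpen_openSimplex (x ∘ g')) hmem)
    refine (openSimplex_subset_convexHull hdet).trans (convexHull_mono ?_)
    rintro _ ⟨b, rfl⟩
    exact ⟨g' b, hg'I b, rfl⟩

/-- Two coinciding points would give two equal rows in the determinant of some d + 1 indices
containing both. -/
lemma injective_of_det_homMatrix_ne_zero {d n : ℕ} {x : Fin n → EuclideanSpace ℝ (Fin d)}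
    (hd : 1 ≤ d) (hn : d + 1 ≤ n)
    (hx : ∀ f : Fin (d + 1) → Fin n, Function.Injective f → (homMatrix (x ∘ f)).det ≠ 0) :
    Function.Injective x := by
  intro i j hij
  by_contra hne
  obtain ⟨s, hs1, -, hs⟩ := Finset.exists_subsuperset_card_eq (s := {i, j}) (t := Finset.univ)
    (n := d + 1) (Finset.subset_univ _) (by rw [Finset.card_pair hne]; omega) (by simpa using hn)
  have hr := Finset.range_orderEmbOfFin s hs
  obtain ⟨a, ha⟩ : i ∈ Set.range (s.orderEmbOfFin hs) := by rw [hr]; exact hs1 (by simp)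
  obtain ⟨b, hb⟩ : j ∈ Set.range (s.orderEmbOfFin hs) := by rw [hr]; exact hs1 (by simp)
  have hab : a ≠ b := by rintro rfl; exact hne (ha.symm.trans hb)
  refine hx _ (s.orderEmbOfFin hs).injective (Matrix.det_zero_of_row_eq hab ?_)
  ext l
  simp only [homMatrix, Matrix.of_apply, Function.comp_apply, ha, hb, hij]

/-- For distinct points the holes correspond to index sets. -/
lemma numHoles_range {d n : ℕ} (k : ℕ) {x : Fin n → EuclideanSpace ℝ (Fin d)}
    (hx : Function.Injective x) :
    (numHoles k (Set.range x) : ℝ) = ∑ I ∈ Finset.powersetCard k (Finset.univ : Finset (Fin n)),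
      (holeEvent (I : Set (Fin n))).indicator (fun _ => (1 : ℝ)) x := by
  classical
  have hset : {H : Finset (EuclideanSpace ℝ (Fin d)) | IsHole k (Set.range x) H}
      = (Finset.map ⟨x, hx⟩) '' (((Finset.powersetCard k (Finset.univ : Finset (Fin n))).filter
        fun I => x ∈ holeEvent (I : Set (Fin n)) : Finset (Finset (Fin n))) : Set _) := by
    have key : ∀ I : Finset (Fin n), IsHole k (Set.range x) (I.map ⟨x, hx⟩) ↔
        I.card = k ∧ x ∈ holeEvent (I : Set (Fin n)) := by
      intro I
      unfold IsHole holeEvent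
      have h1 : ConvexIndependent ℝ
          (fun p : I.map ⟨x, hx⟩ => (p : EuclideanSpace ℝ (Fin d))) ↔
          ∀ i ∈ (I : Set (Fin n)), x i ∉ convexHull ℝ (x '' ((I : Set (Fin n)) \ {i})) := by
        have := convexIndependent_set_iff_notMem_convexHull_sdiff (𝕜 := ℝ) (s := x '' I)
        rw [Set.forall_mem_image] at this
        simp only [Set.image_sdiff hx, Set.image_singleton]
        rw [← this]
        have hc : ((I.map ⟨x, hx⟩ : Finset (EuclideanSpace ℝ (Fin d))) : Set _) = x '' I := by simp
        rw [← hc]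
        rfl
      rw [h1]
      simp [Finset.card_map]
    ext H
    simp only [Set.mem_ofPred_eq, Set.mem_image, Finset.mem_coe, Finset.mem_filter,
      Finset.mem_powersetCard, Finset.subset_univ, true_and]
    constructor
    · intro hH
      obtain ⟨I, rfl⟩ : ∃ I : Finset (Fin n), I.map ⟨x, hx⟩ = H := by
        refine ⟨Finset.univ.filter fun i => x i ∈ H, ?_⟩
        ext p
        simp only [Finset.mem_map, Finset.mem_filter, Finset.mem_univ, true_and,
          Function.Embedding.coeFn_mk]
        constructor
        · rintro ⟨i, hi, rfl⟩; exact hi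
        · intro hp
          obtain ⟨i, rfl⟩ := hH.1 hp
          exact ⟨i, hp, rfl⟩
      exact ⟨I, (key I).1 hH, rfl⟩
    · rintro ⟨I, hI, rfl⟩
      exact (key I).2 hI
  rw [numHoles, hset, Set.ncard_image_of_injective _ (Finset.map_injective _),
    Set.ncard_coe_finset, Finset.card_filter]
  push_cast
  rfl

/-! ### Probability of a hole and the expectation -/

lemma uniformPoints_eq {d : ℕ} {K : Set (EuclideanSpace ℝ (Fin d))} (hK1 : volume K = 1) (n : ℕ) :
    uniformPoints K n = Measure.pi fun _ : Fin n => volume.restrict K := by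
  simp [uniformPoints, ProbabilityTheory.cond, hK1]

lemma ae_uniformPoints {d n : ℕ} {K : Set (EuclideanSpace ℝ (Fin d))}
    (hKm : MeasurableSet K) (hK1 : volume K = 1) :
    ∀ᵐ x ∂uniformPoints K n, (∀ i, x i ∈ K) ∧
      ∀ f : Fin (d + 1) → Fin n, Function.Injective f → (homMatrix (x ∘ f)).det ≠ 0 := by
  rw [uniformPoints_eq hK1, ← Measure.restrict_pi_pi]
  have h1 : ∀ᵐ x ∂((Measure.pi fun _ : Fin n => volume).restrict (Set.univ.pi fun _ => K)),
      ∀ i, x i ∈ K := by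
    filter_upwards [ae_restrict_mem (MeasurableSet.univ_pi fun _ => hKm)] with x hx i
    exact hx i trivial
  have h2 : ∀ᵐ x : Fin n → EuclideanSpace ℝ (Fin d), ∀ f : Fin (d + 1) → Fin n,
      Function.Injective f → (homMatrix (x ∘ f)).det ≠ 0 := by
    rw [ae_all_iff]
    intro f
    by_cases hf : Function.Injective f
    · filter_upwards [ae_det_homMatrix_ne_zero hf] with x hx _ using hx
    · exact Filter.Eventually.of_forall fun x h => absurd h hf
  exact h1.and (ae_restrict_of_ae h2)

/-- Union bound over pairs of a base d-set and an apex: the base can be chosen in `(c + 3 +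
m).choose (c + 2)` ways and leaves m + 1 choices of apex. One labelling per pair suffices. -/
lemma measure_holeEvent_le {c n m r : ℕ} {K : Set (EuclideanSpace ℝ (Fin (c + 2)))}
    (hKm : MeasurableSet K) (hKc : Convex ℝ K) (hK1 : volume K = 1) (hn : n = c + 3 + m + r)
    {I : Finset (Fin n)} (hI : I.card = c + 3 + m) :
    uniformPoints K n (holeEvent (I : Set (Fin n))) ≤
      ((c + 3 + m).choose (c + 2) * (m + 1) : ℕ) * ENNReal.ofReal (2 ^ (c + 1) *
        ((c + 2).factorial * (2 ^ (c + 2) * (c + 2).factorial) ^ m *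
        (m.factorial / ((r : ℝ) + 1) ^ (m + 1)))) := by
  classical
  set b := ENNReal.ofReal (2 ^ (c + 1) *
        ((c + 2).factorial * (2 ^ (c + 2) * (c + 2).factorial : ℝ) ^ m *
        (m.factorial / ((r : ℝ) + 1) ^ (m + 1)))) with hb
  have : IsProbabilityMeasure (volume.restrict K) := ⟨by simpa using hK1⟩
  -- Any nonzero vector of weight 0, that is, any direction, would serve.
  set u : Fin (c + 3) → ℝ := Pi.single (Fin.last _) 1 with hu
  have hu0 : u 0 = 0 := by simp [hu, (Fin.last_pos (n := c + 1)).ne]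
  have hune : u ≠ 0 := fun h => by
    have := congrFun h (Fin.last _)
    simp [hu] at this
  set T := (Finset.powersetCard (c + 2) I).sigma fun D => I \ D with hT
  have hlab : ∀ t ∈ T, ∃ e : Fin (c + 2 + 1) ⊕ (Fin m ⊕ Fin r) ≃ Fin n, e (Sum.inl 0) = t.2 ∧
      (∀ i : Fin (c + 2), e (Sum.inl i.succ) ∈ t.1) ∧ ∀ i, e (Sum.inr (Sum.inl i)) ∈ I := by
    intro t ht
    obtain ⟨h1, h2⟩ := Finset.mem_sigma.1 ht
    obtain ⟨h3, h4⟩ := Finset.mem_powersetCard.1 h1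
    exact exists_labelling h3 h4 h2 (by omega) (by omega)
  have : Nonempty (Fin (c + 2 + 1) ⊕ (Fin m ⊕ Fin r) ≃ Fin n) :=
    ⟨Fintype.equivOfCardEq (by simp only [Fintype.card_sum, Fintype.card_fin]; omega)⟩
  choose! e he using hlab
  set A : (Σ _ : Finset (Fin n), Fin n) → Set (Fin n → EuclideanSpace ℝ (Fin (c + 2))) := fun t =>
    (fun x => ((fun i => x (e t (Sum.inl i)),
        (fun i => x (e t (Sum.inr (Sum.inl i))), fun i => x (e t (Sum.inr (Sum.inr i))))))) ⁻¹'
      emptyConfigurations K u m r with hA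
  have hAle : ∀ t ∈ T, uniformPoints K n (A t) ≤ b := by
    intro t _
    rw [uniformPoints_eq hK1, hA]
    simp only
    rw [(measurePreserving_splitSum (volume.restrict K) (e t)).measure_preimage
      (measurableSet_emptyConfigurations hKm u m r).nullMeasurableSet]
    exact measure_emptyConfigurations_le hKm hKc hK1 hu0 m r
  have hsub : (holeEvent (I : Set (Fin n)) : Set (Fin n → EuclideanSpace ℝ (Fin (c + 2))))
      ≤ᵐ[uniformPoints K n] ⋃ t ∈ T, A t := by
    filter_upwards [ae_uniformPoints hKm hK1] with x hx hole
    obtain ⟨D, hD, j, hj, h⟩ := mem_emptyConfigurations_of_mem_holeEvent (m := m) (r := r)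
      hx.2 hx.1 hune (by omega) hole
    have ht : (⟨D, j⟩ : Σ _ : Finset (Fin n), Fin n) ∈ T := Finset.mem_sigma.2 ⟨hD, hj⟩
    refine Set.mem_biUnion ht ?_
    obtain ⟨h1, h2, h3⟩ := he _ ht
    exact h _ h1 h2 h3
  have hcard : T.card = (c + 3 + m).choose (c + 2) * (m + 1) := by
    rw [hT, Finset.card_sigma, Finset.sum_congr rfl fun D hD => ?_, Finset.sum_const,
      Finset.card_powersetCard, hI, smul_eq_mul]
    obtain ⟨h3, h4⟩ := Finset.mem_powersetCard.1 hD
    rw [Finset.card_sdiff_of_subset h3, hI, h4]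
    omega
  calc _ ≤ uniformPoints K n (⋃ t ∈ T, A t) := measure_mono_ae hsub
    _ ≤ ∑ t ∈ T, uniformPoints K n (A t) := measure_biUnion_finset_le _ _
    _ ≤ ∑ _t ∈ T, b := Finset.sum_le_sum hAle
    _ = _ := by rw [Finset.sum_const, hcard, nsmul_eq_mul]

/-- Almost surely the points are distinct, so holes correspond to index sets and expectation is
linear. Integrability ensures that `EH` is not the default value 0 of the integral. -/
lemma integrable_numHoles_and_EH_eq {d k n : ℕ} {K : Set (EuclideanSpace ℝ (Fin d))}
    (hd : 1 ≤ d) (hn : d + 1 ≤ n) (hKm : MeasurableSet K) (hK1 : volume K = 1) :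
    Integrable (fun x : Fin n → EuclideanSpace ℝ (Fin d) =>
      (numHoles k (Set.range x) : ℝ)) (uniformPoints K n) ∧
    EH K k n = ∑ I ∈ Finset.powersetCard k (Finset.univ : Finset (Fin n)),
      (uniformPoints K n).real (holeEvent (I : Set (Fin n))) := by
  have : IsProbabilityMeasure (volume.restrict K) := ⟨by simpa using hK1⟩
  have hprob : IsProbabilityMeasure (uniformPoints K n) := by
    rw [uniformPoints_eq hK1]; infer_instance
  have hae : (fun x : Fin n → EuclideanSpace ℝ (Fin d) => (numHoles k (Set.range x) : ℝ))
      =ᵐ[uniformPoints K n] fun x => ∑ I ∈ Finset.powersetCard k (Finset.univ : Finset (Fin n)),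
        (holeEvent (I : Set (Fin n))).indicator (fun _ => (1 : ℝ)) x := by
    filter_upwards [ae_uniformPoints hKm hK1] with x hx
    exact numHoles_range k (injective_of_det_homMatrix_ne_zero hd hn hx.2)
  have hint : ∀ I ∈ Finset.powersetCard k (Finset.univ : Finset (Fin n)),
      Integrable ((holeEvent (I : Set (Fin n)) : Set (Fin n → EuclideanSpace ℝ (Fin d))).indicator
        fun _ => (1 : ℝ)) (uniformPoints K n) := fun I _ =>
    (integrable_const _).indicator (measurableSet_holeEvent _)
  refine ⟨(integrable_finsetSum _ hint).congr hae.symm, ?_⟩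
  rw [EH, integral_congr_ae hae, integral_finsetSum _ hint]
  refine Finset.sum_congr rfl fun I _ => ?_
  rw [integral_indicator_const _ (measurableSet_holeEvent _), smul_eq_mul, mul_one]

/-! ### Numerical estimates and the final bound -/

lemma prod_range_sub_eq_descFactorial (n : ℕ) : ∀ k : ℕ, k ≤ n →
    ∏ i ∈ Finset.range k, ((n : ℝ) - (i : ℝ)) = n.descFactorial k := by
  intro k hk
  rw [Nat.descFactorial_eq_prod_range]
  push_cast
  refine Finset.prod_congr rfl fun i hi => ?_
  rw [Nat.cast_sub]
  exact (Finset.mem_range.1 hi).le.trans hk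

/-- The probabilistic argument yields the constant (2^d d!)^m without a denominator m!; this
comparison pays for the m! in the stated bound. -/
lemma pow_mul_factorial_le {d k : ℕ} (hd : 2 ≤ d) (hk : d + 1 ≤ k) :
    (2 ^ d * d.factorial) ^ (k - d - 1) * (k - d - 1).factorial
      ≤ (2 * d ^ (2 * d - 1) * k.choose (d / 2)) ^ (k - d - 1) := by
  set m := k - d - 1 with hm
  have h1 : d.factorial ≤ d ^ (d - 1) := by
    obtain ⟨c, rfl⟩ : ∃ c, d = c + 1 := ⟨d - 1, by omega⟩
    simp only [Nat.add_sub_cancel]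
    rw [← Finset.prod_range_add_one_eq_factorial, Finset.prod_range_succ']
    simp only [zero_add, mul_one]
    calc _ ≤ ∏ _i ∈ Finset.range c, (c + 1) := Finset.prod_le_prod' fun i hi => by
          have := Finset.mem_range.1 hi; omega
      _ = _ := by simp
  have h2 : 2 ^ d * d.factorial ≤ 2 * d ^ (2 * d - 1) := by
    calc 2 ^ d * d.factorial = 2 * (2 ^ (d - 1) * d.factorial) := by
          rw [← mul_assoc, ← pow_succ']; congr 2; omega
      _ ≤ 2 * (d ^ (d - 1) * d ^ (d - 1)) := by gcongr
      _ = 2 * d ^ (2 * d - 2) := by rw [← pow_add]; congr 2; omega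
      _ ≤ _ := by gcongr <;> omega
  -- Here m ≤ k = C(k, 1) ≤ C(k, d/2), as a row of Pascal's triangle increases up to its middle and
  -- 1 ≤ d/2 ≤ k/2.
  have h3 : m ≤ k.choose (d / 2) := by
    have h4 : ∀ j, 1 ≤ j → j ≤ k / 2 → k.choose 1 ≤ k.choose j := fun j hj =>
      Nat.le_induction (fun _ => le_rfl)
        (fun j _ ih h => (ih (by omega)).trans (Nat.choose_le_succ_of_lt_half_left (by omega))) j hj
    have h4 := h4 (d / 2) (by omega) (by omega)
    rw [Nat.choose_one_right] at h4
    omega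
  calc _ ≤ (2 * d ^ (2 * d - 1)) ^ m * (k.choose (d / 2)) ^ m := by
        gcongr
        exact (Nat.factorial_le_pow m).trans (Nat.pow_le_pow_left h3 m)
    _ = _ := (mul_pow _ _ _).symm

lemma choose_mul_choose_mul_factorial {n d m : ℕ} :
    n.choose (d + 1 + m) * ((d + 1 + m).choose d * (m + 1)) * (d.factorial * m.factorial)
      = n.descFactorial (d + 1 + m) := by
  have h1 := Nat.choose_mul_factorial_mul_factorial (n := d + 1 + m) (k := d) (by omega)
  rw [show d + 1 + m - d = m + 1 by omega, Nat.factorial_succ] at h1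
  rw [Nat.descFactorial_eq_factorial_mul_choose, ← h1]
  ring

lemma EH_le {d k n : ℕ} (hd : 2 ≤ d) (hk : d + 1 ≤ k) (hn : k ≤ n)
    {K : Set (EuclideanSpace ℝ (Fin d))} (hK : IsConvexBody K) (hK1 : volume K = 1) :
    EH K k n ≤
      2 ^ (d - 1) * (2 * (d : ℝ) ^ (2 * d - 1) * (k.choose (d / 2) : ℝ)) ^ (k - d - 1) *
        ((∏ i ∈ Finset.range (k - 1), ((n : ℝ) - (i : ℝ))) /
          (((k - d - 1).factorial : ℝ) * ((n : ℝ) - (k : ℝ) + 1) ^ (k - d - 1))) := by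
  have hpow := pow_mul_factorial_le hd hk
  obtain ⟨c, rfl⟩ : ∃ c, d = c + 2 := ⟨d - 2, by omega⟩
  obtain ⟨m, rfl⟩ : ∃ m, k = c + 3 + m := ⟨k - (c + 3), by omega⟩
  obtain ⟨r, rfl⟩ : ∃ r, n = c + 3 + m + r := ⟨n - (c + 3 + m), by omega⟩
  have hKm := hK.1.isClosed.measurableSet
  rw [show c + 3 + m - (c + 2) - 1 = m by omega] at hpow ⊢
  set n := c + 3 + m + r with hn'
  set b : ℝ := 2 ^ (c + 1) * ((c + 2).factorial * (2 ^ (c + 2) * (c + 2).factorial : ℝ) ^ m *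
        (m.factorial / ((r : ℝ) + 1) ^ (m + 1))) with hb
  have hb0 : 0 ≤ b := by positivity
  rw [(integrable_numHoles_and_EH_eq (by omega) (by omega) hKm hK1).2]
  have hterm : ∀ I ∈ Finset.powersetCard (c + 3 + m) (Finset.univ : Finset (Fin n)),
      (uniformPoints K n).real (holeEvent (I : Set (Fin n)))
        ≤ ((c + 3 + m).choose (c + 2) * (m + 1) : ℕ) * b := by
    intro I hI
    have h := measure_holeEvent_le hKm hK.2.1 hK1 hn' (Finset.mem_powersetCard.1 hI).2
    rw [← hb, ← ENNReal.ofReal_natCast, ← ENNReal.ofReal_mul (by positivity)] at h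
    exact ENNReal.toReal_le_of_le_ofReal (by positivity) h
  refine (Finset.sum_le_sum hterm).trans ?_
  rw [Finset.sum_const, Finset.card_powersetCard, Finset.card_univ, Fintype.card_fin, nsmul_eq_mul]
  set Q : ℝ := ∏ i ∈ Finset.range (c + 3 + m - 1), ((n : ℝ) - (i : ℝ)) with hQ
  have hr : (n : ℝ) - ((c + 3 + m : ℕ) : ℝ) + 1 = r + 1 := by rw [hn']; push_cast; ring
  -- The falling factorial of length k is `Q` times its last factor n - k + 1 = r + 1, which removes
  -- one power from the Beta bound.
  have hcount : (n.choose (c + 3 + m) : ℝ) * ((c + 3 + m).choose (c + 2) * (m + 1) : ℕ) *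
      ((c + 2).factorial * m.factorial) = Q * (r + 1) := by
    have h1 := choose_mul_choose_mul_factorial (n := n) (d := c + 2) (m := m)
    have h2 := prod_range_sub_eq_descFactorial n (c + 3 + m) (by omega)
    rw [show c + 3 + m = (c + 3 + m - 1) + 1 by omega, Finset.prod_range_succ, ← hQ,
      ← show c + 3 + m = (c + 3 + m - 1) + 1 by omega] at h2
    have h3 : (n : ℝ) - ((c + 3 + m - 1 : ℕ) : ℝ) = r + 1 := by
      rw [← hr, show c + 3 + m = (c + 3 + m - 1) + 1 by omega, Nat.add_sub_cancel]
      push_cast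
      ring
    rw [← h3, h2]
    exact_mod_cast h1
  have hQ0 : 0 ≤ Q := Finset.prod_nonneg fun i hi => by
    have h1 := Finset.mem_range.1 hi
    have : (i : ℝ) ≤ n := by exact_mod_cast (by omega : i ≤ n)
    linarith
  have hpow' : (2 ^ (c + 2) * (c + 2).factorial : ℝ) ^ m * m.factorial
      ≤ (2 * ((c + 2 : ℕ) : ℝ) ^ (2 * (c + 2) - 1) *
        ((c + 3 + m).choose ((c + 2) / 2) : ℝ)) ^ m := by
    exact_mod_cast hpow
  rw [hr, show c + 2 - 1 = c + 1 by omega]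
  have hr1 : (0 : ℝ) < r + 1 := by positivity
  have hm : (0 : ℝ) < m.factorial := by positivity
  calc _ = 2 ^ (c + 1) * (2 ^ (c + 2) * (c + 2).factorial : ℝ) ^ m *
        (((n.choose (c + 3 + m) : ℝ) * ((c + 3 + m).choose (c + 2) * (m + 1) : ℕ) *
      ((c + 2).factorial * m.factorial)) / (r + 1) ^ (m + 1)) := by rw [hb]; ring
    _ = 2 ^ (c + 1) * ((2 ^ (c + 2) * (c + 2).factorial : ℝ) ^ m * m.factorial) *
        (Q / (m.factorial * (r + 1) ^ m)) := by
      rw [hcount]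
      field_simp
      ring
    _ ≤ _ := by gcongr

lemma prod_div_pow_le {d k n : ℕ} (hk : d + 1 ≤ k) (hn : k ≤ n) :
    (∏ i ∈ Finset.range (k - 1), ((n : ℝ) - (i : ℝ))) / ((n : ℝ) - (k : ℝ) + 1) ^ (k - d - 1)
      ≤ (k : ℝ) ^ (k - d - 1) * (n : ℝ) ^ d := by
  have hkn : (k : ℝ) ≤ n := by exact_mod_cast hn
  have hk1 : (1 : ℝ) ≤ k := by exact_mod_cast (by omega : 1 ≤ k)
  have hpos : 0 < (n : ℝ) - k + 1 := by linarith
  rw [div_le_iff₀ (by positivity)]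
  have h1 : ∏ i ∈ Finset.range (k - 1), ((n : ℝ) - (i : ℝ)) ≤ (n : ℝ) ^ (k - 1) := by
    calc _ ≤ ∏ _i ∈ Finset.range (k - 1), (n : ℝ) := by
          refine Finset.prod_le_prod (fun i hi => ?_) fun i _ => ?_
          · have h := Finset.mem_range.1 hi
            have : (i : ℝ) ≤ n := by exact_mod_cast (by omega : i ≤ n)
            linarith
          · have : (0 : ℝ) ≤ i := by positivity
            linarith
      _ = _ := by simp
  -- The difference of the two sides is (k - 1)(n - k).
  have h2 : (n : ℝ) ≤ k * ((n : ℝ) - k + 1) := by nlinarith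
  calc _ ≤ (n : ℝ) ^ (k - 1) := h1
    _ = (n : ℝ) ^ (k - d - 1) * (n : ℝ) ^ d := by rw [← pow_add]; congr 1; omega
    _ ≤ (k * ((n : ℝ) - k + 1)) ^ (k - d - 1) * (n : ℝ) ^ d := by gcongr
    _ = _ := by rw [mul_pow]; ring

theorem theorem2 (d k : ℕ) (hd : 2 ≤ d) (hk : d + 1 ≤ k) :
    (∃ C : ℝ, ∀ K : Set (EuclideanSpace ℝ (Fin d)), IsConvexBody K → volume K = 1 →
      ∀ n : ℕ, k ≤ n → EH K k n ≤ C * (n : ℝ) ^ d) ∧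
    (∀ K : Set (EuclideanSpace ℝ (Fin d)), IsConvexBody K → volume K = 1 →
      ∀ n : ℕ, k ≤ n →
        Integrable (fun x : Fin n → EuclideanSpace ℝ (Fin d) =>
          (numHoles k (Set.range x) : ℝ)) (uniformPoints K n) ∧
        EH K k n ≤
          2 ^ (d - 1) * (2 * (d : ℝ) ^ (2 * d - 1) * (k.choose (d / 2) : ℝ)) ^ (k - d - 1) *
            ((∏ i ∈ Finset.range (k - 1), ((n : ℝ) - (i : ℝ))) /
              (((k - d - 1).factorial : ℝ) * ((n : ℝ) - (k : ℝ) + 1) ^ (k - d - 1)))) := by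
  refine ⟨⟨2 ^ (d - 1) * (2 * (d : ℝ) ^ (2 * d - 1) * (k.choose (d / 2) : ℝ)) ^ (k - d - 1) *
    ((k : ℝ) ^ (k - d - 1) / (k - d - 1).factorial), fun K hK hK1 n hn => ?_⟩,
    fun K hK hK1 n hn => ⟨?_, EH_le hd hk hn hK hK1⟩⟩
  · refine (EH_le hd hk hn hK hK1).trans ?_
    rw [mul_assoc _ ((k : ℝ) ^ (k - d - 1) / _)]
    gcongr
    rw [mul_comm ((k - d - 1).factorial : ℝ), ← div_div, div_mul_eq_mul_div]
    gcongr
    exact prod_div_pow_le hk hn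
  · exact (integrable_numHoles_and_EH_eq (by omega) (by omega) hK.1.isClosed.measurableSet hK1).1
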